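/- Let $d\ge 1$ be an integer and $p>1$. For $s\in(0,1)$ and a measurable function $u:\mathbb{R}^d\to\mathbb{R}$ put \[ [u]_{W^{s,p}(\mathbb{R}^d)}=\left(\int_{\mathbb{R}^d}\int_{\mathbb{R}^d}\frac{|u(x)-u(y)|^p}{|x-y|^{d+sp}}\,dx\,dy\right)^{1/p}, \] and let $W^{s,p}(\mathbb{R}^d)$ be the completion of $C_c^\infty(\mathbb{R}^d)$ under the norm $\left(\|u\|_{L^p(\mathbb{R}^d)}^p+[u]_{W^{s,p}(\mathbb{R}^d)}^p\right)^{1/p}$, regarded as a space of (classes of) functions in $L^p(\mathbb{R}^d)$. For $q>p$ let $\mathcal{D}^{p,q}_s=\left(W^{s,p}(\mathbb{R}^d)\cap L^q(\mathbb{R}^d)\right)\setminus\{0\}$. **Theorem 2.2.** There is a constant $C(d,p)>0$, depending only on $d$ and $p$, such that the following holds. Let $s\in(0,1)$ be such that $sp<d$, let $p<q<\frac{p(d-s)}{d-sp}$, and put \[ r=p\,\frac{q-1}{p-1},\qquad \delta=dp-(d-sp)q,\qquad a=\frac{d(q-p)}{(q-1)\left(dp-(d-sp)q\right)},\qquad \mathcal{C}=C(d,p)\,\frac{s(1-s)}{(d-sp)^{p-1}}.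 \] Then $\delta>0$, and for every $u\in\mathcal{D}^{p,q}_s$, \[ \|u\|_{L^r(\mathbb{R}^d)}\le \mathcal{C}^{\frac{a}{p}}\,[u]_{W^{s,p}(\mathbb{R}^d)}^{a}\,\|u\|_{L^q(\mathbb{R}^d)}^{1-a}. \] -/

import Mathlib

open scoped ENNReal

namespace FracSobolev

open MeasureTheory

/-- The Gagliardo seminorm `[u]_{W^{s,p}(ℝ^d)}`, with values in `[0, ∞]`. The diagonal, where the
integrand is given the value `0`, is a null set for `d ≥ 1`. -/
noncomputable def gagliardo (d : ℕ) (s p : ℝ) (u : EuclideanSpace ℝ (Fin d) → ℝ) : ℝ≥0∞ :=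
  (∫⁻ y, ∫⁻ x, ENNReal.ofReal (|u x - u y| ^ p / ‖x - y‖ ^ ((d : ℝ) + s * p))) ^ (1 / p)

/-- The norm `(‖u‖_{L^p}^p + [u]_{W^{s,p}}^p)^{1/p}`, with values in `[0, ∞]`. -/
noncomputable def wspNorm (d : ℕ) (s p : ℝ) (u : EuclideanSpace ℝ (Fin d) → ℝ) : ℝ≥0∞ :=
  (eLpNorm u (ENNReal.ofReal p) volume ^ p + gagliardo d s p u ^ p) ^ (1 / p)

/-- `u` represents an element of `W^{s,p}(ℝ^d)`, the completion of the smooth compactly supported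
functions for `wspNorm`. The completion embeds in `L^p(ℝ^d)`, and it is realized here as the closure
of the smooth compactly supported functions in the space of all (a.e. strongly) measurable functions
of finite norm. -/
def MemWsp (d : ℕ) (s p : ℝ) (u : EuclideanSpace ℝ (Fin d) → ℝ) : Prop :=
  AEStronglyMeasurable u volume ∧ wspNorm d s p u < ∞ ∧
    ∀ ε : ℝ≥0∞, 0 < ε → ∃ φ : EuclideanSpace ℝ (Fin d) → ℝ,
      ContDiff ℝ (⊤ : ℕ∞) φ ∧ HasCompactSupport φ ∧ wspNorm d s p (fun x => u x - φ x) < ε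

/-- `u` represents an element of `𝒟^{p,q}_s = (W^{s,p}(ℝ^d) ∩ L^q(ℝ^d)) \ {0}`; functions are
identified when they agree almost everywhere. -/
def MemD (d : ℕ) (s p q : ℝ) (u : EuclideanSpace ℝ (Fin d) → ℝ) : Prop :=
  MemWsp d s p u ∧ MemLp u (ENNReal.ofReal q) volume ∧ ¬ u =ᵐ[volume] 0

/-- The constant `𝒞 = C s (1 - s) / (d - s p)^{p-1}`, in terms of a factor `C = C(d, p)`. -/
noncomputable def sobolevConst (C : ℝ) (d : ℕ) (s p : ℝ) : ℝ :=
  C * (s * (1 - s) / ((d : ℝ) - s * p) ^ (p - 1))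

/-- The interpolation exponent `a = d (q - p) / ((q - 1) (d p - (d - s p) q))`. -/
noncomputable def interpExp (d : ℕ) (s p q : ℝ) : ℝ :=
  (d : ℝ) * (q - p) / ((q - 1) * ((d : ℝ) * p - ((d : ℝ) - s * p) * q))

end FracSobolev

/-! The inequality is the interpolation ‖u‖_r ≤ ‖u‖_P^a ‖u‖_q^(1-a) with P = dp/(d-sp), combined
with the fractional Sobolev inequality ‖u‖_P^p ≤ C(d,p) s(1-s)/(d-sp)^(p-1) [u]^p (`fracSobolev`).
All the work lies in the three factors of that constant. Write n for the dimension and G for [u]^p.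

The factor 1-s: inserting midpoints bounds the differences of u at distance ρ by those at distance
ρ/2, so every dyadic scale below ρ carries its share of G (`diffMeasure_shell_le`).

The factor (n-sp)^(-(p-1)): the L^p mean of u over a ball is telescoped along balls of doubling
radius that move off to infinity in a fixed direction. Consecutive balls lie in slabs of bounded
overlap, so the pieces of G add up to at most 2G, and Hölder over the scales costs only the power
p-1 (`lpMean_ball_le`). Averaging over translates turns this into a weak-type inequality for
arbitrary sets (`rpow_mul_volume_rpow_le`), and Maz'ya's dyadic truncation upgrades it to the strong
one (`levelSum_le_one_sub`).

The factor s: a point of a superlevel set interacts with the far complement of the next lower one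
with strength of order 1/s (`le_setLIntegral_compl`). A Hölder argument on the level sets then gives
the bound for small s (`levelSum_le_of_small`). -/

namespace FracSobolev

open MeasureTheory Module Set

set_option linter.unusedSectionVars false

/-! ### Dyadic shells, midpoints and the factor 1-s. -/

section General

variable {E : Type*} [NormedAddCommGroup E] [NormedSpace ℝ E] [FiniteDimensional ℝ E]
  [MeasureSpace E] [BorelSpace E] [(volume : Measure E).IsAddHaarMeasure]

/-- The measure `|u x - u y|^p dx dy`. -/
noncomputable def diffMeasure (p : ℝ) (u : E → ℝ) : Measure (E × E) :=
  (volume : Measure (E × E)).withDensity fun z => ‖u z.1 - u z.2‖ₑ ^ p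

/-- The measure `|u x - u y|^p / |x - y|^{n + s p} dx dy`; its total mass is the `p`-th power of the
Gagliardo seminorm. -/
noncomputable def gagliardoMeasure (s p : ℝ) (u : E → ℝ) : Measure (E × E) :=
  (volume : Measure (E × E)).withDensity fun z =>
    ‖u z.1 - u z.2‖ₑ ^ p * ENNReal.ofReal (1 / ‖z.1 - z.2‖ ^ ((finrank ℝ E : ℝ) + s * p))

/-- The pairs of points of `Q` at distance in `[ρ, 2ρ)`. -/
def shell (Q : Set E) (ρ : ℝ) : Set (E × E) :=
  {z | (z.1 ∈ Q ∧ z.2 ∈ Q) ∧ ρ ≤ ‖z.1 - z.2‖ ∧ ‖z.1 - z.2‖ < 2 * ρ}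

lemma mem_shell {Q : Set E} {ρ : ℝ} {x y : E} :
    (x, y) ∈ shell Q ρ ↔ (x ∈ Q ∧ y ∈ Q) ∧ ρ ≤ ‖x - y‖ ∧ ‖x - y‖ < 2 * ρ := Iff.rfl

lemma measurableSet_shell {Q : Set E} (hQ : MeasurableSet Q) (ρ : ℝ) :
    MeasurableSet (shell Q ρ) := by
  have h1 : Measurable fun z : E × E => ‖z.1 - z.2‖ := by fun_prop
  exact ((measurable_fst hQ).inter (measurable_snd hQ)).inter
    ((measurableSet_le measurable_const h1).inter (measurableSet_lt h1 measurable_const))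

lemma lintegral_midpoint {f : E → ℝ≥0∞} (hf : Measurable f) (x : E) :
    ∫⁻ y, f (midpoint ℝ x y) = 2 ^ finrank ℝ E * ∫⁻ y, f y := by
  have h1 : ∀ y, f (midpoint ℝ x y) = (fun y => f ((⅟2 : ℝ) • x + (⅟2 : ℝ) • y)) y := by
    intro y; simp only [midpoint_eq_smul_add, smul_add]
  have h2 : Measurable fun y : E => f ((⅟2 : ℝ) • x + y) := hf.comp (measurable_const_add _)
  have h3 : ∫⁻ y, f ((⅟2 : ℝ) • x + (⅟2 : ℝ) • y)
      = ∫⁻ y, f ((⅟2 : ℝ) • x + y) ∂(Measure.map (fun y => (⅟2 : ℝ) • y) volume) := by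
    rw [lintegral_map h2 (measurable_const_smul _)]
  simp only [h1]
  rw [h3, Measure.map_addHaar_smul _ (by norm_num), lintegral_smul_measure,
    lintegral_add_left_eq_self]
  congr 1
  rw [invOf_eq_inv, inv_pow, inv_inv, abs_of_pos (by positivity),
    ENNReal.ofReal_pow (by norm_num)]
  simp

lemma measurable_diff {p : ℝ} {u : E → ℝ} (hu : Measurable u) :
    Measurable fun z : E × E => ‖u z.1 - u z.2‖ₑ ^ p := by
  have : Measurable fun z : E × E => u z.1 - u z.2 :=
    (hu.comp measurable_fst).sub (hu.comp measurable_snd)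
  exact this.enorm.pow_const p

/-- If m is the midpoint of x and y, then m lies in Q by convexity, and |u x - u y|^p ≤ 2^(p-1) (|u
x - u m|^p + |u y - u m|^p). The two terms contribute equally, and the substitution y ↦ m costs 2^n.
-/
lemma diffMeasure_shell_le_half {p : ℝ} (hp : 1 ≤ p) {u : E → ℝ} (hu : Measurable u) {Q : Set E}
    (hQ : MeasurableSet Q) (hQc : Convex ℝ Q) (ρ : ℝ) :
    diffMeasure p u (shell Q ρ) ≤
      ENNReal.ofReal (2 ^ (p + finrank ℝ E)) * diffMeasure p u (shell Q (ρ / 2)) := by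
  set g : E → E → ℝ≥0∞ := fun x y =>
    (shell Q (ρ / 2)).indicator (fun z => ‖u z.1 - u z.2‖ₑ ^ p) (x, y) with hg
  have hgm : Measurable (Function.uncurry g) :=
    (measurable_diff hu).indicator (measurableSet_shell hQ _)
  have hpt : ∀ x y, (shell Q ρ).indicator (fun z => ‖u z.1 - u z.2‖ₑ ^ p) (x, y)
      ≤ 2 ^ (p - 1) * (g x (midpoint ℝ x y) + g y (midpoint ℝ y x)) := by
    intro x y
    by_cases h : (x, y) ∈ shell Q ρ
    · have hm : midpoint ℝ x y ∈ Q := hQc.midpoint_mem h.1.1 h.1.2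
      obtain ⟨⟨hx, hy⟩, h1, h2⟩ := mem_shell.1 h
      have e1 : ‖x - midpoint ℝ x y‖ = ‖x - y‖ / 2 := by
        rw [← dist_eq_norm, dist_left_midpoint, dist_eq_norm]; norm_num; ring
      have e2 : ‖y - midpoint ℝ x y‖ = ‖x - y‖ / 2 := by
        rw [← dist_eq_norm, dist_right_midpoint, dist_eq_norm]; norm_num; ring
      have i1 : (x, midpoint ℝ x y) ∈ shell Q (ρ / 2) :=
        mem_shell.2 ⟨⟨hx, hm⟩, by rw [e1]; linarith, by rw [e1]; linarith⟩
      have i2 : (y, midpoint ℝ x y) ∈ shell Q (ρ / 2) :=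
        mem_shell.2 ⟨⟨hy, hm⟩, by rw [e2]; linarith, by rw [e2]; linarith⟩
      rw [midpoint_comm y x]
      simp only [hg, indicator_of_mem h, indicator_of_mem i1, indicator_of_mem i2]
      refine le_trans ?_ (ENNReal.rpow_add_le_mul_rpow_add_rpow _ _ hp)
      gcongr
      have : u x - u y = (u x - u (midpoint ℝ x y)) - (u y - u (midpoint ℝ x y)) := by ring
      rw [this]
      exact enorm_sub_le
    · rw [indicator_of_notMem h]; exact zero_le
  have hL : ∀ R : ℝ, diffMeasure p u (shell Q R) =
      ∫⁻ x, ∫⁻ y, (shell Q R).indicator (fun z => ‖u z.1 - u z.2‖ₑ ^ p) (x, y) := by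
    intro R
    have hS := measurableSet_shell hQ R
    rw [diffMeasure, withDensity_apply _ hS, ← lintegral_indicator hS, Measure.volume_eq_prod,
      lintegral_prod _ ((measurable_diff hu).indicator hS).aemeasurable]
  have hmid : ∀ x, ∫⁻ y, g x (midpoint ℝ x y) = 2 ^ finrank ℝ E * ∫⁻ y, g x y :=
    fun x => lintegral_midpoint (hgm.comp measurable_prodMk_left) x
  have hmeas1 : Measurable (Function.uncurry fun x y => g x (midpoint ℝ x y)) := by
    have : Measurable fun z : E × E => (z.1, midpoint ℝ z.1 z.2) := by
      simp only [midpoint_eq_smul_add]; fun_prop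
    exact hgm.comp this
  have hmeas2 : Measurable (Function.uncurry fun x y => g y (midpoint ℝ y x)) :=
    hmeas1.comp measurable_swap
  rw [hL, hL]
  calc _ ≤ ∫⁻ x, ∫⁻ y, 2 ^ (p - 1) * (g x (midpoint ℝ x y) + g y (midpoint ℝ y x)) :=
        lintegral_mono fun x => lintegral_mono fun y => hpt x y
    _ = 2 ^ (p - 1) * ((∫⁻ x, ∫⁻ y, g x (midpoint ℝ x y))
          + ∫⁻ x, ∫⁻ y, g y (midpoint ℝ y x)) := by
        have a1 : ∀ x, ∫⁻ y, 2 ^ (p - 1) * (g x (midpoint ℝ x y) + g y (midpoint ℝ y x))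
            = 2 ^ (p - 1) * ((∫⁻ y, g x (midpoint ℝ x y)) + ∫⁻ y, g y (midpoint ℝ y x)) := by
          intro x
          have m1 : Measurable fun y => g x (midpoint ℝ x y) :=
            hmeas1.comp measurable_prodMk_left
          have m2 : Measurable fun y => g y (midpoint ℝ y x) :=
            hmeas2.comp measurable_prodMk_left
          rw [lintegral_const_mul' _ _ (by finiteness), lintegral_add_left m1]
        simp only [a1]
        rw [lintegral_const_mul' _ _ (by finiteness), lintegral_add_left hmeas1.lintegral_prod_right]
    _ = 2 ^ (p - 1) * (2 * (2 ^ finrank ℝ E * ∫⁻ x, ∫⁻ y, g x y)) := by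
        rw [lintegral_lintegral_swap (f := fun x y => g y (midpoint ℝ y x)) hmeas2.aemeasurable]
        simp only [hmid]
        rw [lintegral_const_mul _ hgm.lintegral_prod_right]
        ring
    _ = _ := by
        rw [← mul_assoc, ← mul_assoc]
        congr 1
        rw [← ENNReal.ofReal_rpow_of_pos two_pos, ENNReal.ofReal_ofNat,
          ENNReal.rpow_add _ _ two_ne_zero ENNReal.ofNat_ne_top, ENNReal.rpow_natCast]
        congr 1
        nth_rewrite 2 [← ENNReal.rpow_one 2]
        rw [← ENNReal.rpow_add _ _ two_ne_zero ENNReal.ofNat_ne_top]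
        congr 1; ring

lemma diffMeasure_shell_le_dyadic {p : ℝ} (hp : 1 ≤ p) {u : E → ℝ} (hu : Measurable u) {Q : Set E}
    (hQ : MeasurableSet Q) (hQc : Convex ℝ Q) (ρ : ℝ) (k : ℕ) :
    diffMeasure p u (shell Q ρ) ≤
      ENNReal.ofReal ((2 ^ (p + finrank ℝ E)) ^ k) * diffMeasure p u (shell Q (ρ / 2 ^ k)) := by
  induction k with
  | zero => simp
  | succ k ih =>
    refine ih.trans ?_
    have := diffMeasure_shell_le_half hp hu hQ hQc (ρ / 2 ^ k)
    rw [pow_succ, ENNReal.ofReal_mul (by positivity), mul_assoc, pow_succ 2 k, ← div_div]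
    gcongr

lemma measurable_gagliardo_kernel (c : ℝ) :
    Measurable fun z : E × E => ENNReal.ofReal (1 / ‖z.1 - z.2‖ ^ c) := by
  have h1 : Measurable fun z : E × E => ‖z.1 - z.2‖ := by fun_prop
  exact ((h1.pow_const c).const_div 1).ennreal_ofReal

lemma diffMeasure_le_gagliardoMeasure {s p : ℝ} (hs : 0 ≤ s) (hp : 0 ≤ p) {u : E → ℝ}
    {S : Set (E × E)} (hS : MeasurableSet S) {R : ℝ}
    (h : ∀ z ∈ S, 0 < ‖z.1 - z.2‖ ∧ ‖z.1 - z.2‖ ≤ R) :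
    diffMeasure p u S ≤
      ENNReal.ofReal (R ^ ((finrank ℝ E : ℝ) + s * p)) * gagliardoMeasure s p u S := by
  rw [diffMeasure, gagliardoMeasure, withDensity_apply _ hS, withDensity_apply _ hS,
    ← lintegral_const_mul' _ _ ENNReal.ofReal_ne_top]
  refine setLIntegral_mono' hS fun z hz => ?_
  obtain ⟨h0, h1⟩ := h z hz
  rw [mul_left_comm, ← ENNReal.ofReal_mul (by have := h0.trans_le h1; positivity)]
  refine le_mul_of_one_le_right zero_le ?_
  rw [ENNReal.one_le_ofReal, mul_one_div, one_le_div (by positivity)]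
  exact Real.rpow_le_rpow h0.le h1 (by positivity)

lemma one_le_one_sub_two_rpow_neg {x : ℝ} (hx : 0 < x) : 1 - (2 : ℝ) ^ (-x) ≤ x := by
  have h := Real.add_one_le_exp (-(x * Real.log 2))
  rw [Real.rpow_def_of_pos two_pos, mul_neg, mul_comm (Real.log 2)]
  have : Real.log 2 ≤ 1 := by linarith [Real.log_two_lt_d9]
  nlinarith

/-- The Bourgain-Brezis-Mironescu gain of a factor `1 - s`. -/
lemma diffMeasure_shell_le {s p : ℝ} (hs : 0 ≤ s) (hs1 : s < 1) (hp : 1 ≤ p) {u : E → ℝ}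
    (hu : Measurable u) {Q : Set E} (hQ : MeasurableSet Q) (hQc : Convex ℝ Q) {ρ : ℝ}
    (hρ : 0 < ρ) :
    diffMeasure p u (shell Q ρ) ≤
      ENNReal.ofReal (p * (1 - s) * (2 * ρ) ^ ((finrank ℝ E : ℝ) + s * p)) *
        gagliardoMeasure s p u (Q ×ˢ Q) := by
  set n : ℝ := (finrank ℝ E : ℝ)
  set x : ℝ := p * (1 - s) with hx
  have hx0 : 0 < x := by rw [hx]; exact mul_pos (by linarith) (by linarith)
  set J := diffMeasure p u (shell Q ρ)
  set A := ENNReal.ofReal ((2 * ρ) ^ (n + s * p))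
  -- Halving k times costs 2^(k(p+n)), while the kernel on the smaller shell gains 2^(-k(n+sp)). The
  -- net loss is only 2^(kp(1-s)).
  have key : ∀ k : ℕ, ENNReal.ofReal ((2 : ℝ) ^ (-x)) ^ k * J ≤
      A * gagliardoMeasure s p u (shell Q (ρ / 2 ^ k)) := by
    intro k
    have h1 := diffMeasure_shell_le_dyadic hp hu hQ hQc ρ k
    have h2 := diffMeasure_le_gagliardoMeasure (u := u) (p := p) (R := 2 * (ρ / 2 ^ k)) hs (by linarith)
      (measurableSet_shell hQ (ρ / 2 ^ k))
      (fun z hz => ⟨lt_of_lt_of_le (by positivity) hz.2.1, hz.2.2.le⟩)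
    calc _ ≤ ENNReal.ofReal ((2 : ℝ) ^ (-x)) ^ k * (ENNReal.ofReal ((2 ^ (p + n)) ^ k) *
        (ENNReal.ofReal ((2 * (ρ / 2 ^ k)) ^ (n + s * p)) *
          gagliardoMeasure s p u (shell Q (ρ / 2 ^ k)))) := by gcongr; exact h1.trans (by gcongr)
      _ = _ := by
        rw [← mul_assoc, ← mul_assoc]
        congr 1
        rw [← ENNReal.ofReal_pow (by positivity), ← ENNReal.ofReal_mul (by positivity),
          ← ENNReal.ofReal_mul (by positivity)]
        congr 1
        rw [mul_div_assoc' 2 ρ, Real.div_rpow (by positivity) (by positivity), ← mul_pow,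
          ← Real.rpow_add two_pos, ← Real.rpow_natCast 2 k, ← Real.rpow_mul two_pos.le,
          ← Real.rpow_natCast (2 ^ _) k, ← Real.rpow_mul two_pos.le]
        have : (-x + (p + n)) * k = k * (n + s * p) := by rw [hx]; ring
        rw [this]
        field_simp
  have hdisj : Pairwise (Function.onFun (AEDisjoint (gagliardoMeasure s p u))
      fun k : ℕ => shell Q (ρ / 2 ^ k)) := by
    have aux : ∀ i j : ℕ, i < j → Disjoint (shell Q (ρ / 2 ^ i)) (shell Q (ρ / 2 ^ j)) := by
      intro i j hij
      rw [Set.disjoint_left]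
      intro z hz hz'
      have h1 := hz.2.1
      have h2 := hz'.2.2
      obtain ⟨m, rfl⟩ := Nat.exists_eq_add_of_lt hij
      have : 2 * (ρ / 2 ^ (i + m + 1)) ≤ ρ / 2 ^ i := by
        rw [pow_succ, pow_add]
        have : (1 : ℝ) ≤ 2 ^ m := one_le_pow₀ (by norm_num)
        rw [mul_div_assoc', div_le_div_iff₀ (by positivity) (by positivity)]
        have : 0 < ρ * 2 ^ i := by positivity
        nlinarith
      linarith
    intro i j hij
    rcases lt_or_gt_of_ne hij with h | h
    · exact (aux i j h).aedisjoint
    · exact (aux j i h).symm.aedisjoint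
  have hsum : ∑' k : ℕ, gagliardoMeasure s p u (shell Q (ρ / 2 ^ k)) ≤
      gagliardoMeasure s p u (Q ×ˢ Q) := by
    rw [← measure_iUnion₀ hdisj fun k => (measurableSet_shell hQ _).nullMeasurableSet]
    refine measure_mono (iUnion_subset fun k z hz => hz.1)
  -- Summed over k, the left side gains the factor 1/(1 - 2^(-p(1-s))) ≥ 1/(p(1-s)), while the
  -- disjoint shells on the right together use G only once.
  have h3 : (1 - ENNReal.ofReal ((2 : ℝ) ^ (-x)))⁻¹ * J ≤
      A * gagliardoMeasure s p u (Q ×ˢ Q) := by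
    rw [← ENNReal.tsum_geometric, ← ENNReal.tsum_mul_right]
    refine (ENNReal.tsum_le_tsum key).trans ?_
    rw [ENNReal.tsum_mul_left]
    gcongr
  have hlt : (2 : ℝ) ^ (-x) < 1 := Real.rpow_lt_one_of_one_lt_of_neg (by norm_num) (by linarith)
  have h4 : (1 - ENNReal.ofReal ((2 : ℝ) ^ (-x))) = ENNReal.ofReal (1 - (2 : ℝ) ^ (-x)) := by
    rw [ENNReal.ofReal_sub _ (by positivity), ENNReal.ofReal_one]
  rw [h4, ENNReal.inv_mul_le_iff (by simpa using hlt) ENNReal.ofReal_ne_top] at h3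
  refine h3.trans ?_
  rw [ENNReal.ofReal_mul hx0.le, mul_assoc]
  gcongr
  exact one_le_one_sub_two_rpow_neg hx0

end General

/-! ### Minkowski's inequality for power means. -/

section Minkowski

variable {Z : Type*} [MeasurableSpace Z]

lemma lintegral_rpow_enorm_le_add {κ : Measure Z} {p : ℝ} (hp : 1 ≤ p) {f g : Z → ℝ}
    (hf : Measurable f) (hg : Measurable g) :
    (∫⁻ z, ‖f z‖ₑ ^ p ∂κ) ^ (1 / p) ≤
      (∫⁻ z, ‖g z‖ₑ ^ p ∂κ) ^ (1 / p) + (∫⁻ z, ‖f z - g z‖ₑ ^ p ∂κ) ^ (1 / p) := by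
  refine le_trans ?_ (ENNReal.lintegral_Lp_add_le (f := fun z => ‖g z‖ₑ)
    (g := fun z => ‖f z - g z‖ₑ) hg.enorm.aemeasurable (hf.sub hg).enorm.aemeasurable hp)
  gcongr with z
  have : f z = g z + (f z - g z) := by ring
  rw [Pi.add_apply]
  nth_rewrite 1 [this]
  exact enorm_add_le _ _

end Minkowski

/-! ### Comparison of means over balls, sets and translates. -/

section General

variable {E : Type*} [NormedAddCommGroup E] [NormedSpace ℝ E] [FiniteDimensional ℝ E]
  [MeasureSpace E] [BorelSpace E] [(volume : Measure E).IsAddHaarMeasure]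

/-- The `p`-th power mean of `|u|` over `A`. -/
noncomputable def lpMean (p : ℝ) (u : E → ℝ) (A : Set E) : ℝ≥0∞ :=
  ((volume A)⁻¹ * ∫⁻ x in A, ‖u x‖ₑ ^ p) ^ (1 / p)

/-- Minkowski's inequality in L^p(A × B) for the functions u(x) and u(y). -/
lemma lpMean_le_add {p : ℝ} (hp : 1 ≤ p) {u : E → ℝ} (hu : Measurable u) {A B : Set E}
    (hA : MeasurableSet A) (hB : MeasurableSet B) (hA0 : volume A ≠ 0) (hA1 : volume A ≠ ∞)
    (hB0 : volume B ≠ 0) (hB1 : volume B ≠ ∞) :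
    lpMean p u A ≤ lpMean p u B +
      ((volume A)⁻¹ * (volume B)⁻¹ * diffMeasure p u (A ×ˢ B)) ^ (1 / p) := by
  have hp0 : 0 ≤ 1 / p := by positivity
  have h := lintegral_rpow_enorm_le_add
    (κ := ((volume : Measure E).restrict A).prod ((volume : Measure E).restrict B)) hp
    (hu.comp measurable_fst) (hu.comp measurable_snd)
  have m1 : Measurable fun x => ‖u x‖ₑ ^ p := hu.enorm.pow_const p
  have e1 : ∫⁻ z, ‖(u ∘ Prod.fst) z‖ₑ ^ p
      ∂((volume : Measure E).restrict A).prod ((volume : Measure E).restrict B)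
      = volume B * ∫⁻ x in A, ‖u x‖ₑ ^ p := by
    have m2 : Measurable fun z : E × E => ‖(u ∘ Prod.fst) z‖ₑ ^ p := m1.comp measurable_fst
    rw [lintegral_prod _ m2.aemeasurable]
    simp only [Function.comp, lintegral_const, Measure.restrict_apply_univ]
    rw [lintegral_mul_const' _ _ hB1, mul_comm]
  have e2 : ∫⁻ z, ‖(u ∘ Prod.snd) z‖ₑ ^ p
      ∂((volume : Measure E).restrict A).prod ((volume : Measure E).restrict B)
      = volume A * ∫⁻ x in B, ‖u x‖ₑ ^ p := by
    have m2 : Measurable fun z : E × E => ‖(u ∘ Prod.snd) z‖ₑ ^ p := m1.comp measurable_snd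
    rw [lintegral_prod _ m2.aemeasurable]
    simp only [Function.comp, lintegral_const, Measure.restrict_apply_univ]
    rw [mul_comm]
  have e3 : ∫⁻ z, ‖(u ∘ Prod.fst) z - (u ∘ Prod.snd) z‖ₑ ^ p
      ∂((volume : Measure E).restrict A).prod ((volume : Measure E).restrict B)
      = diffMeasure p u (A ×ˢ B) := by
    rw [Measure.prod_restrict, ← Measure.volume_eq_prod, diffMeasure,
      withDensity_apply _ (hA.prod hB)]
    rfl
  rw [e1, e2, e3] at h
  have h' := mul_le_mul_right h (((volume A)⁻¹ * (volume B)⁻¹) ^ (1 / p))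
  rw [mul_add, ← ENNReal.mul_rpow_of_nonneg _ _ hp0, ← ENNReal.mul_rpow_of_nonneg _ _ hp0,
    ← ENNReal.mul_rpow_of_nonneg _ _ hp0] at h'
  have c1 : ∀ X : ℝ≥0∞, (volume A)⁻¹ * (volume B)⁻¹ * (volume B * X) = (volume A)⁻¹ * X := by
    intro X
    rw [mul_assoc, ← mul_assoc _ (volume B), ENNReal.inv_mul_cancel hB0 hB1, one_mul]
  have c2 : ∀ X : ℝ≥0∞, (volume A)⁻¹ * (volume B)⁻¹ * (volume A * X) = (volume B)⁻¹ * X := by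
    intro X
    rw [mul_comm (volume A)⁻¹, mul_assoc, ← mul_assoc _ (volume A),
      ENNReal.inv_mul_cancel hA0 hA1, one_mul]
  rwa [c1, c2] at h'

lemma setLIntegral_ball_add {f : E → ℝ≥0∞} (x c : E) (t : ℝ) :
    ∫⁻ h in Metric.ball c t, f (x + h) = ∫⁻ y in Metric.ball (x + c) t, f y := by
  rw [← lintegral_indicator Metric.isOpen_ball.measurableSet,
    ← lintegral_indicator Metric.isOpen_ball.measurableSet,
    ← lintegral_add_left_eq_self ((Metric.ball (x + c) t).indicator f) x]
  congr 1 with h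
  simp [indicator, Metric.mem_ball]

lemma lpMean_rpow {p : ℝ} (hp : 1 ≤ p) (u : E → ℝ) (A : Set E) :
    lpMean p u A ^ p = (volume A)⁻¹ * ∫⁻ x in A, ‖u x‖ₑ ^ p := by
  rw [lpMean, ← ENNReal.rpow_mul, one_div_mul_cancel (by linarith), ENNReal.rpow_one]

/-- Since A need not be localized, u(x) is compared with u(x + h) for h in a fixed ball. At fixed x
the average over h is a mean over `ball (x + c) t`, so a bound uniform in x suffices, and every pair
(x, x + h) lies in a single shell. -/
lemma lpMean_le_of_translates {p : ℝ} (hp : 1 ≤ p) {u : E → ℝ} (hu : Measurable u) {A : Set E}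
    (hA0 : volume A ≠ 0) (hA1 : volume A ≠ ∞) {c : E} {t ρ : ℝ}
    (ht : 0 < t) (hρ : ∀ h ∈ Metric.ball c t, ρ ≤ ‖h‖ ∧ ‖h‖ < 2 * ρ) {M : ℝ≥0∞}
    (hM : ∀ x, lpMean p u (Metric.ball (x + c) t) ≤ M) :
    lpMean p u A ≤ M + ((volume A)⁻¹ * (volume (Metric.ball c t))⁻¹ *
      diffMeasure p u (shell univ ρ)) ^ (1 / p) := by
  have hp0 : 0 ≤ 1 / p := by positivity
  set B := Metric.ball c t with hB
  have hBm : MeasurableSet B := Metric.isOpen_ball.measurableSet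
  have hB0 : volume B ≠ 0 := (Metric.measure_ball_pos _ _ ht).ne'
  have hB1 : volume B ≠ ∞ := measure_ball_lt_top.ne
  have mg : Measurable fun z : E × E => u (z.1 + z.2) :=
    hu.comp (measurable_fst.add measurable_snd)
  have h := lintegral_rpow_enorm_le_add
    (κ := ((volume : Measure E).restrict A).prod ((volume : Measure E).restrict B)) hp
    (hu.comp measurable_fst) mg
  have m1 : Measurable fun x => ‖u x‖ₑ ^ p := hu.enorm.pow_const p
  have e1 : ∫⁻ z, ‖(u ∘ Prod.fst) z‖ₑ ^ p
      ∂((volume : Measure E).restrict A).prod ((volume : Measure E).restrict B)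
      = volume B * ∫⁻ x in A, ‖u x‖ₑ ^ p := by
    have m2 : Measurable fun z : E × E => ‖(u ∘ Prod.fst) z‖ₑ ^ p := m1.comp measurable_fst
    rw [lintegral_prod _ m2.aemeasurable]
    simp only [Function.comp, lintegral_const, Measure.restrict_apply_univ]
    rw [lintegral_mul_const' _ _ hB1, mul_comm]
  have e2 : ∫⁻ z, ‖u (z.1 + z.2)‖ₑ ^ p
      ∂((volume : Measure E).restrict A).prod ((volume : Measure E).restrict B)
      ≤ volume A * (volume B * M ^ p) := by
    rw [lintegral_prod _ (mg.enorm.pow_const p).aemeasurable]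
    have : ∀ x, ∫⁻ h in B, ‖u (x + h)‖ₑ ^ p ≤ volume B * M ^ p := by
      intro x
      rw [hB, setLIntegral_ball_add (f := fun y => ‖u y‖ₑ ^ p), ← hB]
      have h1 := ENNReal.rpow_le_rpow (hM x) (by linarith : 0 ≤ p)
      have h2 : volume (Metric.ball (x + c) t) = volume B := by
        rw [hB, Measure.addHaar_ball_center, Measure.addHaar_ball_center volume c]
      rwa [lpMean_rpow hp, h2, ENNReal.inv_mul_le_iff hB0 hB1] at h1
    refine (lintegral_mono this).trans ?_
    rw [lintegral_const, Measure.restrict_apply_univ, mul_comm]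
  have e3 : ∫⁻ z, ‖(u ∘ Prod.fst) z - u (z.1 + z.2)‖ₑ ^ p
      ∂((volume : Measure E).restrict A).prod ((volume : Measure E).restrict B)
      ≤ diffMeasure p u (shell univ ρ) := by
    have mS := measurableSet_shell (E := E) MeasurableSet.univ ρ
    have mF : Measurable fun z : E × E => ‖u z.1 - u z.2‖ₑ ^ p := measurable_diff hu
    have mD : Measurable fun z : E × E => ‖(u ∘ Prod.fst) z - u (z.1 + z.2)‖ₑ ^ p :=
      (((hu.comp measurable_fst).sub mg).enorm).pow_const p
    rw [diffMeasure, withDensity_apply _ mS, ← lintegral_indicator mS, Measure.volume_eq_prod,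
      lintegral_prod _ (mF.indicator mS).aemeasurable, lintegral_prod _ mD.aemeasurable]
    refine (setLIntegral_le_lintegral _ _).trans (lintegral_mono fun x => ?_)
    dsimp only
    rw [← lintegral_add_left_eq_self (fun y => (shell univ ρ).indicator (fun z => ‖u z.1 - u z.2‖ₑ ^ p) (x, y)) x, ← lintegral_indicator hBm]
    refine lintegral_mono fun h => ?_
    by_cases hh : h ∈ B
    · have : (x, x + h) ∈ shell univ ρ := by
        rw [mem_shell]
        simpa using hρ h hh
      rw [indicator_of_mem hh, indicator_of_mem this]
      rfl
    · rw [indicator_of_notMem hh]; exact zero_le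
  rw [e1] at h
  have h' := mul_le_mul_right (h.trans (add_le_add (ENNReal.rpow_le_rpow e2 hp0)
    (ENNReal.rpow_le_rpow e3 hp0))) (((volume A)⁻¹ * (volume B)⁻¹) ^ (1 / p))
  rw [mul_add, ← ENNReal.mul_rpow_of_nonneg _ _ hp0, ← ENNReal.mul_rpow_of_nonneg _ _ hp0,
    ← ENNReal.mul_rpow_of_nonneg _ _ hp0] at h'
  have c1 : ∀ X : ℝ≥0∞, (volume A)⁻¹ * (volume B)⁻¹ * (volume B * X) = (volume A)⁻¹ * X := by
    intro X
    rw [mul_assoc, ← mul_assoc _ (volume B), ENNReal.inv_mul_cancel hB0 hB1, one_mul]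
  have c2 : ∀ X : ℝ≥0∞, (volume A)⁻¹ * (volume B)⁻¹ * (volume A * (volume B * X)) = X := by
    intro X
    rw [mul_left_comm _ (volume A), c1, ← mul_assoc, ENNReal.mul_inv_cancel hA0 hA1, one_mul]
  rw [c1, c2, ← ENNReal.rpow_mul, mul_one_div_cancel (by linarith), ENNReal.rpow_one] at h'
  exact h'

/-- The constant in the comparison of the means of `u` over neighbouring balls. -/
noncomputable def ballConst (E : Type*) [NormedAddCommGroup E] [NormedSpace ℝ E] [MeasureSpace E]
    (p : ℝ) : ℝ :=
  p * 16 ^ ((finrank ℝ E : ℝ) + p) *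
    (1 / volume.real (Metric.ball (0 : E) 1) + 1 / volume.real (Metric.ball (0 : E) 1) ^ 2)

lemma volumeReal_ball_pos : 0 < volume.real (Metric.ball (0 : E) 1) :=
  ENNReal.toReal_pos (Metric.measure_ball_pos _ _ one_pos).ne' measure_ball_lt_top.ne

lemma volume_ball_eq [Nontrivial E] (x : E) {r : ℝ} (hr : 0 ≤ r) :
    volume (Metric.ball x r) =
      ENNReal.ofReal (r ^ finrank ℝ E * volume.real (Metric.ball (0 : E) 1)) := by
  rw [Measure.addHaar_ball _ _ hr, ENNReal.ofReal_mul (by positivity), Measure.real,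
    ENNReal.ofReal_toReal measure_ball_lt_top.ne]

lemma ballConst_pos {p : ℝ} (hp : 1 ≤ p) : 0 < ballConst E p := by
  have := volumeReal_ball_pos (E := E)
  unfold ballConst
  positivity

/-- Common bookkeeping for the two comparisons: κ = 2·6 for neighbouring balls and κ = 2·8 for
translates. The powers of τ combine to n + sp - 2n. -/
lemma scale_const_le {n : ℕ} {s p τ κ a b C : ℝ} (hs : 0 ≤ s) (hs1 : s < 1) (hp : 1 ≤ p)
    (hτ : 0 < τ) (hκ : 1 ≤ κ) (hκ' : κ ≤ 16)
    (hab : C * (τ ^ n * τ ^ n) ≤ a * b) (hC : 0 < C) :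
    (a)⁻¹ * (b)⁻¹ * (p * (1 - s) * (κ * τ) ^ ((n : ℝ) + s * p)) ≤
      p * 16 ^ ((n : ℝ) + p) * (1 / C) * (1 - s) * τ ^ (-((n : ℝ) - s * p)) := by
  have h1 : κ ^ ((n : ℝ) + s * p) ≤ 16 ^ ((n : ℝ) + p) := by
    calc κ ^ ((n : ℝ) + s * p) ≤ 16 ^ ((n : ℝ) + s * p) :=
          Real.rpow_le_rpow (by linarith) hκ' (by positivity)
      _ ≤ _ := Real.rpow_le_rpow_of_exponent_le (by norm_num) (by nlinarith)
  have h2 : a⁻¹ * b⁻¹ ≤ (1 / C) * (τ ^ n * τ ^ n)⁻¹ := by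
    rw [← mul_inv, one_div, ← mul_inv]
    exact inv_anti₀ (by positivity) hab
  have h3 : τ ^ (-((n : ℝ) - s * p)) = (τ ^ n * τ ^ n)⁻¹ * τ ^ ((n : ℝ) + s * p) := by
    rw [← Real.rpow_natCast, ← Real.rpow_add hτ, ← Real.rpow_neg hτ.le, ← Real.rpow_add hτ]
    congr 1; ring
  have h4 : 0 ≤ p * (1 - s) := mul_nonneg (by linarith) (by linarith)
  rw [h3, Real.mul_rpow (by linarith) hτ.le]
  calc _ ≤ ((1 / C) * (τ ^ n * τ ^ n)⁻¹) * (p * (1 - s) *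
      (16 ^ ((n : ℝ) + p) * τ ^ ((n : ℝ) + s * p))) := by gcongr
    _ = _ := by ring

/-- The slab `8τ < ℓ (z - x) < 20τ`. -/
def slab (ℓ : E →L[ℝ] ℝ) (x : E) (τ : ℝ) : Set E := {z | 8 * τ < ℓ (z - x) ∧ ℓ (z - x) < 20 * τ}

lemma measurableSet_slab (ℓ : E →L[ℝ] ℝ) (x : E) (τ : ℝ) : MeasurableSet (slab ℓ x τ) := by
  have h1 : Measurable fun z => ℓ (z - x) := by fun_prop
  exact (measurableSet_lt measurable_const h1).inter (measurableSet_lt h1 measurable_const)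

lemma convex_slab (ℓ : E →L[ℝ] ℝ) (x : E) (τ : ℝ) : Convex ℝ (slab ℓ x τ) := by
  intro y hy z hz a b ha hb hab
  have e : ℓ (a • y + b • z - x) = a * ℓ (y - x) + b * ℓ (z - x) := by
    simp only [map_sub, map_add, map_smul, smul_eq_mul]
    linear_combination (ℓ x) * hab
  obtain ⟨h1, h2⟩ := hy
  obtain ⟨h3, h4⟩ := hz
  rw [slab, mem_ofPred_eq, e]
  have hb' : b = 1 - a := by linarith
  subst hb'
  rcases eq_or_lt_of_le ha with rfl | ha'
  · constructor <;> linarith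
  · constructor <;> nlinarith

/-- The error involves only the part of G inside one slab. This localization is what later allows
the errors of all scales to be summed without losing a further power of n - sp. -/
lemma lpMean_ball_le_step [Nontrivial E] {s p : ℝ} (hs : 0 ≤ s) (hs1 : s < 1) (hp : 1 ≤ p)
    {u : E → ℝ} (hu : Measurable u) {e : E} (he : ‖e‖ = 1) {ℓ : E →L[ℝ] ℝ} (hℓ : ‖ℓ‖ = 1)
    (hℓe : ℓ e = 1) (x : E) {τ : ℝ} (hτ : 0 < τ) :
    lpMean p u (Metric.ball (x + (9 * τ) • e) τ) ≤
      lpMean p u (Metric.ball (x + (9 * (2 * τ)) • e) (2 * τ)) +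
      (ENNReal.ofReal (ballConst E p * (1 - s) * τ ^ (-((finrank ℝ E : ℝ) - s * p))) *
        gagliardoMeasure s p u (slab ℓ x τ ×ˢ slab ℓ x τ)) ^ (1 / p) := by
  set A := Metric.ball (x + (9 * τ) • e) τ
  set B := Metric.ball (x + (9 * (2 * τ)) • e) (2 * τ)
  set Q := slab ℓ x τ
  have hω := volumeReal_ball_pos (E := E)
  set ω := volume.real (Metric.ball (0 : E) 1) with hωd
  have ht2 : 0 < 2 * τ := by linarith
  refine (lpMean_le_add (A := A) (B := B) hp hu Metric.isOpen_ball.measurableSet Metric.isOpen_ball.measurableSet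
    (Metric.measure_ball_pos _ _ hτ).ne' measure_ball_lt_top.ne
    (Metric.measure_ball_pos _ _ ht2).ne' measure_ball_lt_top.ne).trans ?_
  have hbound : ∀ (c : ℝ) (r : ℝ) (z : E), z ∈ Metric.ball (x + c • e) r →
      |ℓ (z - x) - c| < r := by
    intro c r z hz
    have h1 : ℓ (z - x) - c = ℓ (z - (x + c • e)) := by
      simp only [map_sub, map_add, map_smul, hℓe, smul_eq_mul]; ring
    rw [h1, ← Real.norm_eq_abs]
    refine (ℓ.le_opNorm _).trans_lt ?_
    rw [hℓ, one_mul]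
    simpa [dist_eq_norm] using hz
  -- The centres are 9τ apart and the radii add up to 3τ, so the distances lie between 6τ and 12τ.
  -- The functional ℓ(· - x) ranges in (8τ, 10τ) on A and in (16τ, 20τ) on B.
  have hsub : A ×ˢ B ⊆ shell Q (6 * τ) := by
    rintro ⟨y, z⟩ ⟨hy, hz⟩
    have h1 := abs_lt.1 (hbound _ _ _ hy)
    have h2 := abs_lt.1 (hbound _ _ _ hz)
    have hy' : ‖y - (x + (9 * τ) • e)‖ < τ := by simpa [A, dist_eq_norm] using hy
    have hz' : ‖z - (x + (9 * (2 * τ)) • e)‖ < 2 * τ := by simpa [B, dist_eq_norm] using hz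
    have hn : ‖(9 * τ) • e‖ = 9 * τ := by
      rw [norm_smul, he, mul_one, Real.norm_of_nonneg (by positivity)]
    have e1 : z - y = (z - (x + (9 * (2 * τ)) • e)) - (y - (x + (9 * τ) • e)) + (9 * τ) • e := by
      module
    have e2 : (9 * τ) • e =
        (z - y) - ((z - (x + (9 * (2 * τ)) • e)) - (y - (x + (9 * τ) • e))) := by
      rw [e1]; abel
    have h3 := norm_sub_le (z - (x + (9 * (2 * τ)) • e)) (y - (x + (9 * τ) • e))
    have h4 : ‖z - y‖ < 12 * τ := by
      rw [e1]
      refine (norm_add_le _ _).trans_lt ?_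
      linarith
    have h5 : 6 * τ ≤ ‖z - y‖ := by
      have := norm_sub_le (z - y) ((z - (x + (9 * (2 * τ)) • e)) - (y - (x + (9 * τ) • e)))
      rw [← e2, hn] at this
      linarith
    refine mem_shell.2 ⟨⟨⟨by linarith, by linarith⟩, ⟨by linarith, by linarith⟩⟩, ?_, ?_⟩
    · rw [norm_sub_rev]; exact h5
    · rw [norm_sub_rev]; linarith
  refine add_le_add le_rfl (ENNReal.rpow_le_rpow ?_ (by positivity))
  have hd := (measure_mono hsub).trans (diffMeasure_shell_le hs hs1 hp hu
    (measurableSet_slab ℓ x τ) (convex_slab ℓ x τ) (by positivity : 0 < 6 * τ))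
  have hA : volume A = ENNReal.ofReal (τ ^ finrank ℝ E * ω) := volume_ball_eq _ hτ.le
  have hB : volume B = ENNReal.ofReal ((2 * τ) ^ finrank ℝ E * ω) := volume_ball_eq _ ht2.le
  rw [hA, hB, ← ENNReal.ofReal_inv_of_pos (by positivity),
    ← ENNReal.ofReal_inv_of_pos (by positivity), ← ENNReal.ofReal_mul (by positivity)]
  refine (mul_le_mul_right hd _).trans ?_
  rw [← mul_assoc, ← ENNReal.ofReal_mul (by positivity)]
  refine mul_le_mul_left (ENNReal.ofReal_le_ofReal ?_) _
  rw [← mul_assoc 2 6]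
  refine (scale_const_le (C := ω ^ 2) hs hs1 hp hτ (by norm_num) (by norm_num) ?_
    (by positivity)).trans ?_
  · have : τ ^ finrank ℝ E ≤ (2 * τ) ^ finrank ℝ E := by gcongr; linarith
    calc _ = τ ^ finrank ℝ E * ω * (τ ^ finrank ℝ E * ω) := by ring
      _ ≤ _ := by gcongr
  · have h1s : 0 ≤ 1 - s := by linarith
    unfold ballConst
    rw [← hωd]
    gcongr
    have : 0 < 1 / ω := by positivity
    linarith

end General

/-! ### Summation over scales. -/

section Sums

/-- The sets of even index are pairwise disjoint, and so are those of odd index. -/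
lemma tsum_measure_le_two_mul {Z : Type*} [MeasurableSpace Z] (ν : Measure Z) {S : ℕ → Set Z}
    (hS : ∀ k, MeasurableSet (S k)) (hd : ∀ i j, i + 2 ≤ j → Disjoint (S i) (S j)) :
    ∑' k, ν (S k) ≤ 2 * ν univ := by
  have aux : ∀ a : ℕ → ℕ, (∀ i j, i < j → a i + 2 ≤ a j) → ∑' k, ν (S (a k)) ≤ ν univ := by
    intro a ha
    refine tsum_measure_le_measure_univ (fun k => (hS _).nullMeasurableSet) fun i j hij => ?_
    rcases lt_or_gt_of_ne hij with h | h
    · exact (hd _ _ (ha _ _ h)).aedisjoint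
    · exact (hd _ _ (ha _ _ h)).symm.aedisjoint
  rw [← tsum_even_add_odd ENNReal.summable ENNReal.summable, two_mul]
  exact add_le_add (aux _ fun i j h => by omega) (aux _ fun i j h => by omega)

lemma inv_one_sub_two_rpow_neg_le {α : ℝ} (hα : 0 < α) :
    (1 - ENNReal.ofReal ((2 : ℝ) ^ (-α)))⁻¹ ≤ ENNReal.ofReal (2 * (1 + α) / α) := by
  have hlt : (2 : ℝ) ^ (-α) < 1 := Real.rpow_lt_one_of_one_lt_of_neg (by norm_num) (by linarith)
  rw [← ENNReal.ofReal_one, ← ENNReal.ofReal_sub _ (by positivity),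
    ← ENNReal.ofReal_inv_of_pos (by linarith)]
  refine ENNReal.ofReal_le_ofReal ?_
  rw [inv_le_comm₀ (by linarith) (by positivity), inv_div, Real.rpow_neg two_pos.le]
  have h := Real.add_one_le_exp (α * Real.log 2)
  rw [mul_comm, ← Real.rpow_def_of_pos two_pos] at h
  have hl : 1 / 2 ≤ Real.log 2 := by linarith [Real.log_two_gt_d9]
  have h2 : 1 + α / 2 ≤ (2 : ℝ) ^ α := by nlinarith
  have h3 : ((2 : ℝ) ^ α)⁻¹ ≤ (1 + α / 2)⁻¹ := inv_anti₀ (by positivity) h2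
  have h4 : α / (2 * (1 + α)) ≤ 1 - (1 + α / 2)⁻¹ := by
    rw [inv_eq_one_div, one_sub_div (by positivity), div_le_div_iff₀ (by positivity) (by positivity)]
    nlinarith [sq_nonneg α]
  linarith

/-- Hölder with exponents p and p/(p-1). The decay rate is written α(p-1) so that the conjugate
power of the weights is geometric of ratio 2^(-α); its sum is raised to the power p-1. -/
lemma sum_geometric_rpow_le {p : ℝ} (hp : 1 < p) {α : ℝ} (hα : 0 < α) (b : ℝ≥0∞) (g : ℕ → ℝ≥0∞)
    (K : ℕ) :
    ∑ k ∈ Finset.range K, (b * ENNReal.ofReal ((2 : ℝ) ^ (-(α * (p - 1)))) ^ k * g k) ^ (1 / p) ≤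
      (b * ENNReal.ofReal ((2 * (1 + α) / α) ^ (p - 1)) * ∑' k, g k) ^ (1 / p) := by
  have hp0 : 0 ≤ 1 / p := by positivity
  have hp1 : 0 < p - 1 := by linarith
  set q := Real.conjExponent p with hq
  have hconj : p.HolderConjugate q := Real.HolderConjugate.conjExponent hp
  have hqp : q = p / (p - 1) := rfl
  have hq0 : 0 < q := hconj.symm.pos
  set a : ℕ → ℝ≥0∞ := fun k => b * ENNReal.ofReal ((2 : ℝ) ^ (-(α * (p - 1)))) ^ k with ha
  have h := ENNReal.inner_le_Lp_mul_Lq (Finset.range K) (fun k => a k ^ (1 / p))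
    (fun k => g k ^ (1 / p)) hconj.symm
  have e1 : ∀ k, (a k ^ (1 / p)) ^ q = b ^ (1 / (p - 1)) * ENNReal.ofReal ((2 : ℝ) ^ (-α)) ^ k := by
    intro k
    have : 1 / p * q = 1 / (p - 1) := by rw [hqp]; field_simp
    rw [← ENNReal.rpow_mul, this, ha, ENNReal.mul_rpow_of_nonneg _ _ (by positivity)]
    congr 1
    rw [← ENNReal.rpow_natCast, ← ENNReal.rpow_natCast, ← ENNReal.rpow_mul, mul_comm (k : ℝ),
      ENNReal.rpow_mul, ENNReal.ofReal_rpow_of_pos (by positivity), ← Real.rpow_mul two_pos.le]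
    congr 3
    field_simp
  have e2 : ∀ k, (g k ^ (1 / p)) ^ p = g k := by
    intro k
    rw [← ENNReal.rpow_mul, one_div_mul_cancel (by linarith), ENNReal.rpow_one]
  have e3 : ∑ k ∈ Finset.range K, (a k ^ (1 / p)) ^ q ≤
      b ^ (1 / (p - 1)) * ENNReal.ofReal (2 * (1 + α) / α) := by
    simp only [e1]
    rw [← Finset.mul_sum]
    gcongr
    refine (ENNReal.sum_le_tsum _).trans ?_
    rw [ENNReal.tsum_geometric]
    exact inv_one_sub_two_rpow_neg_le hα
  have e4 : ∑ k ∈ Finset.range K, (g k ^ (1 / p)) ^ p ≤ ∑' k, g k := by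
    simp only [e2]
    exact ENNReal.sum_le_tsum _
  calc _ = ∑ k ∈ Finset.range K, a k ^ (1 / p) * g k ^ (1 / p) := by
        simp only [ha, ENNReal.mul_rpow_of_nonneg _ _ hp0]
    _ ≤ _ := h
    _ ≤ (b ^ (1 / (p - 1)) * ENNReal.ofReal (2 * (1 + α) / α)) ^ (1 / q) *
          (∑' k, g k) ^ (1 / p) := by gcongr
    _ = _ := by
        rw [ENNReal.mul_rpow_of_nonneg _ _ hp0]
        congr 1
        rw [ENNReal.mul_rpow_of_nonneg _ _ (by positivity), ENNReal.mul_rpow_of_nonneg _ _ hp0,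
          ← ENNReal.rpow_mul, ← ENNReal.ofReal_rpow_of_pos (by positivity), ← ENNReal.rpow_mul]
        congr 2
        · rw [hqp]; field_simp
        · rw [hqp]; field_simp

end Sums

/-! ### Means over single balls and the weak-type inequality. -/

section General

variable {E : Type*} [NormedAddCommGroup E] [NormedSpace ℝ E] [FiniteDimensional ℝ E]
  [MeasureSpace E] [BorelSpace E] [(volume : Measure E).IsAddHaarMeasure]

/-- Slabs whose indices differ by at least 2 are disjoint, because 20 < 8·4. -/
lemma tsum_gagliardoMeasure_slab_le {s p : ℝ} {u : E → ℝ} (ℓ : E →L[ℝ] ℝ) (x : E) {t : ℝ}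
    (ht : 0 < t) :
    ∑' k : ℕ, gagliardoMeasure s p u (slab ℓ x (2 ^ k * t) ×ˢ slab ℓ x (2 ^ k * t)) ≤
      2 * gagliardoMeasure s p u univ := by
  refine tsum_measure_le_two_mul _
    (fun k => (measurableSet_slab ℓ x _).prod (measurableSet_slab ℓ x _)) fun i j hij => ?_
  rw [Set.disjoint_left]
  rintro z ⟨⟨-, h1⟩, -⟩ ⟨⟨h2, -⟩, -⟩
  obtain ⟨m, rfl⟩ := Nat.exists_eq_add_of_le hij
  have h3 : (1 : ℝ) ≤ 2 ^ m := one_le_pow₀ (by norm_num)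
  rw [pow_add, pow_add] at h2
  have : 0 < 2 ^ i * t := by positivity
  nlinarith

lemma tendsto_lpMean_ball [Nontrivial E] {p : ℝ} (hp : 1 ≤ p) {u : E → ℝ}
    (hup : ∫⁻ x, ‖u x‖ₑ ^ p ≠ ∞) (c : ℕ → E) {t : ℝ} (ht : 0 < t) :
    Filter.Tendsto (fun k : ℕ => lpMean p u (Metric.ball (c k) (2 ^ k * t))) Filter.atTop
      (nhds 0) := by
  have hω := volumeReal_ball_pos (E := E)
  set ω := volume.real (Metric.ball (0 : E) 1) with hωd
  have hn : 1 ≤ finrank ℝ E := finrank_pos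
  have hle : ∀ k : ℕ, lpMean p u (Metric.ball (c k) (2 ^ k * t)) ≤
      ((ENNReal.ofReal (2 ^ k * (t ^ finrank ℝ E * ω)))⁻¹ * ∫⁻ x, ‖u x‖ₑ ^ p) ^ (1 / p) := by
    intro k
    rw [lpMean, volume_ball_eq _ (by positivity)]
    refine ENNReal.rpow_le_rpow (mul_le_mul' (ENNReal.inv_le_inv.2 (ENNReal.ofReal_le_ofReal ?_))
      (setLIntegral_le_lintegral _ _)) (by positivity)
    rw [mul_pow, mul_assoc, ← pow_mul]
    gcongr
    · norm_num
    · nlinarith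
  refine tendsto_of_tendsto_of_tendsto_of_le_of_le tendsto_const_nhds ?_ (fun _ => zero_le) hle
  have h1 : Filter.Tendsto (fun k : ℕ => (2 : ℝ) ^ k * (t ^ finrank ℝ E * ω)) Filter.atTop
      Filter.atTop :=
    (tendsto_pow_atTop_atTop_of_one_lt (by norm_num)).atTop_mul_const (by positivity)
  have h2 := tendsto_inv_iff.2 (ENNReal.tendsto_ofReal_atTop.comp h1)
  rw [ENNReal.inv_top] at h2
  have h3 := ENNReal.Tendsto.mul_const h2 (Or.inr hup)
  rw [zero_mul] at h3
  have h4 := h3.ennrpow_const (1 / p)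
  rwa [ENNReal.zero_rpow_of_pos (by positivity)] at h4

/-- The constant in the bound for the means of `u` over balls. -/
noncomputable def meanConst (E : Type*) [NormedAddCommGroup E] [NormedSpace ℝ E] [MeasureSpace E]
    (p : ℝ) : ℝ :=
  ballConst E p * (2 * (2 * (p - 1 + finrank ℝ E)) ^ (p - 1))

/-- The mean telescopes along the balls of centre x + 9·2^k t e and radius 2^k t. The means tend to
0 since u is in L^p and the volumes grow, so only the summed errors remain. -/
lemma lpMean_ball_le [Nontrivial E] {s p : ℝ} (hs : 0 ≤ s) (hs1 : s < 1) (hp : 1 < p)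
    (hsp : s * p < finrank ℝ E) {u : E → ℝ} (hu : Measurable u) (hup : ∫⁻ x, ‖u x‖ₑ ^ p ≠ ∞)
    {e : E} (he : ‖e‖ = 1) (x : E) {t : ℝ} (ht : 0 < t) :
    lpMean p u (Metric.ball (x + (9 * t) • e) t) ≤
      (ENNReal.ofReal (meanConst E p * ((1 - s) / ((finrank ℝ E : ℝ) - s * p) ^ (p - 1)) *
        t ^ (-((finrank ℝ E : ℝ) - s * p))) * gagliardoMeasure s p u univ) ^ (1 / p) := by
  set n : ℝ := (finrank ℝ E : ℝ) with hn
  have hC := ballConst_pos (E := E) hp.le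
  set C := ballConst E p
  obtain ⟨ℓ, hℓ, hℓe⟩ := exists_dual_vector ℝ e (by rw [he]; exact one_ne_zero)
  have hℓe' : ℓ e = 1 := by rw [hℓe, he]; rfl
  have hp1 : 0 < p - 1 := by linarith
  have hns : 0 < n - s * p := by linarith
  have h1s : 0 < 1 - s := by linarith
  set g : ℕ → ℝ≥0∞ := fun k =>
    gagliardoMeasure s p u (slab ℓ x (2 ^ k * t) ×ˢ slab ℓ x (2 ^ k * t))
  set N : ℕ → ℝ≥0∞ := fun k =>
    lpMean p u (Metric.ball (x + (9 * (2 ^ k * t)) • e) (2 ^ k * t)) with hN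
  set α : ℝ := (n - s * p) / (p - 1) with hα
  have hα0 : 0 < α := by positivity
  have hαp : α * (p - 1) = n - s * p := by rw [hα]; field_simp
  set b : ℝ≥0∞ := ENNReal.ofReal (C * (1 - s) * t ^ (-(n - s * p))) with hb
  have hstep : ∀ k, N k ≤ N (k + 1) +
      (b * ENNReal.ofReal ((2 : ℝ) ^ (-(α * (p - 1)))) ^ k * g k) ^ (1 / p) := by
    intro k
    have h := lpMean_ball_le_step hs hs1 hp.le hu he hℓ hℓe' x (τ := 2 ^ k * t) (by positivity)
    have e2 : 2 * (2 ^ k * t) = 2 ^ (k + 1) * t := by ring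
    rw [e2] at h
    refine h.trans (le_of_eq ?_)
    congr 3
    rw [hb, ← ENNReal.ofReal_pow (by positivity), ← ENNReal.ofReal_mul (by positivity)]
    congr 1
    rw [hαp, Real.mul_rpow (by positivity) ht.le, ← Real.rpow_natCast, ← Real.rpow_natCast,
      ← Real.rpow_mul two_pos.le, ← Real.rpow_mul two_pos.le, mul_comm (k : ℝ)]
    ring
  have hsum : ∀ K, N 0 ≤ N K + ∑ k ∈ Finset.range K,
      (b * ENNReal.ofReal ((2 : ℝ) ^ (-(α * (p - 1)))) ^ k * g k) ^ (1 / p) := by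
    intro K
    induction K with
    | zero => simp
    | succ K ih =>
      rw [Finset.sum_range_succ, add_comm (∑ k ∈ Finset.range K, _), ← add_assoc]
      exact ih.trans (by gcongr; exact hstep K)
  set M := (b * ENNReal.ofReal ((2 * (1 + α) / α) ^ (p - 1)) * ∑' k, g k) ^ (1 / p) with hM
  have hK : ∀ K, N 0 ≤ N K + M := fun K =>
    (hsum K).trans (by gcongr; exact sum_geometric_rpow_le hp hα0 b g K)
  have hlim : N 0 ≤ M := by
    have h := (tendsto_lpMean_ball hp.le hup (fun k => x + (9 * (2 ^ k * t)) • e) ht).add_const M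
    rw [zero_add] at h
    exact ge_of_tendsto' h hK
  have hN0 : N 0 = lpMean p u (Metric.ball (x + (9 * t) • e) t) := by simp [hN]
  rw [← hN0]
  refine hlim.trans ?_
  rw [hM]
  refine ENNReal.rpow_le_rpow ?_ (by positivity)
  refine (mul_le_mul_right (tsum_gagliardoMeasure_slab_le ℓ x ht) _).trans ?_
  rw [← mul_assoc, hb, ← ENNReal.ofReal_mul (by positivity), ← ENNReal.ofReal_ofNat 2,
    ← ENNReal.ofReal_mul (by positivity)]
  refine mul_le_mul_left (ENNReal.ofReal_le_ofReal ?_) _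
  have h5 : 2 * (1 + α) / α ≤ (2 * (p - 1 + n)) / (n - s * p) := by
    have e5 : 2 * (1 + α) / α = 2 * (p - 1 + (n - s * p)) / (n - s * p) := by
      rw [hα]; field_simp
    rw [e5]
    gcongr
    nlinarith
  have h6 : (2 * (1 + α) / α) ^ (p - 1) ≤
      (2 * (p - 1 + n)) ^ (p - 1) / (n - s * p) ^ (p - 1) := by
    rw [← Real.div_rpow (by positivity) hns.le]
    exact Real.rpow_le_rpow (by positivity) h5 hp1.le
  calc _ ≤ C * (1 - s) * t ^ (-(n - s * p)) *
        ((2 * (p - 1 + n)) ^ (p - 1) / (n - s * p) ^ (p - 1)) * 2 := by gcongr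
    _ = _ := by rw [meanConst]; ring

/-- The constant in the weak-type inequality. -/
noncomputable def weakConst (E : Type*) [NormedAddCommGroup E] [NormedSpace ℝ E] [MeasureSpace E]
    (p : ℝ) : ℝ := 2 ^ p * meanConst E p

lemma meanConst_pos {p : ℝ} (hp : 1 < p) : 0 < meanConst E p := by
  have := ballConst_pos (E := E) hp.le
  have : 0 < p - 1 := by linarith
  unfold meanConst
  positivity

lemma weakConst_pos {p : ℝ} (hp : 1 < p) : 0 < weakConst E p := by
  have := meanConst_pos (E := E) hp
  unfold weakConst
  positivity

lemma rpow_le_of_le_enorm [Nontrivial E] {s p : ℝ} (hs : 0 ≤ s) (hs1 : s < 1) (hp : 1 < p)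
    (hsp : s * p < finrank ℝ E) {u : E → ℝ} (hu : Measurable u) (hup : ∫⁻ x, ‖u x‖ₑ ^ p ≠ ∞)
    {A : Set E} (hA : MeasurableSet A) {t : ℝ} (ht : 0 < t)
    (hAt : volume A = ENNReal.ofReal (t ^ finrank ℝ E)) {lam : ℝ≥0∞}
    (hlam : ∀ x ∈ A, lam ≤ ‖u x‖ₑ) :
    lam ^ p ≤ ENNReal.ofReal (weakConst E p * ((1 - s) / ((finrank ℝ E : ℝ) - s * p) ^ (p - 1)) *
        t ^ (-((finrank ℝ E : ℝ) - s * p))) * gagliardoMeasure s p u univ := by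
  set n : ℝ := (finrank ℝ E : ℝ) with hn
  have hp1 : 0 < p - 1 := by linarith
  have hns : 0 < n - s * p := by linarith
  have h1s : 0 < 1 - s := by linarith
  have hC := ballConst_pos (E := E) hp.le
  have hm := meanConst_pos (E := E) hp
  have hA0 : volume A ≠ 0 := by
    rw [hAt, ne_eq, ENNReal.ofReal_eq_zero, not_le]; positivity
  have hA1 : volume A ≠ ∞ := by rw [hAt]; exact ENNReal.ofReal_ne_top
  obtain ⟨e, he⟩ := exists_norm_eq E zero_le_one
  set z := ENNReal.ofReal (meanConst E p * ((1 - s) / (n - s * p) ^ (p - 1)) *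
        t ^ (-(n - s * p))) * gagliardoMeasure s p u univ with hz
  have h1 : lam ^ p ≤ lpMean p u A ^ p := by
    rw [lpMean_rpow hp.le, mul_comm, ← div_eq_mul_inv, ENNReal.le_div_iff_mul_le (Or.inl hA0)
      (Or.inl hA1), ← setLIntegral_const]
    exact setLIntegral_mono' hA fun x hx => ENNReal.rpow_le_rpow (hlam x hx) (by linarith)
  -- Here ‖h‖ lies between 8t and 10t, inside the dyadic range [8t, 16t).
  have hρ : ∀ h ∈ Metric.ball ((9 * t) • e) t, 8 * t ≤ ‖h‖ ∧ ‖h‖ < 2 * (8 * t) := by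
    intro h hh
    have hh' : ‖h - (9 * t) • e‖ < t := by simpa [dist_eq_norm] using hh
    have hne : ‖(9 * t) • e‖ = 9 * t := by
      rw [norm_smul, he, mul_one, Real.norm_of_nonneg (by positivity)]
    have h3 := norm_sub_norm_le h ((9 * t) • e)
    have h4 := norm_sub_norm_le ((9 * t) • e) h
    rw [norm_sub_rev] at h4
    constructor <;> linarith
  have h2 := lpMean_le_of_translates hp.le hu hA0 hA1 ht hρ
    (fun x => lpMean_ball_le hs hs1 hp hsp hu hup he x ht)
  have h3 : (volume A)⁻¹ * (volume (Metric.ball ((9 * t) • e) t))⁻¹ *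
      diffMeasure p u (shell univ (8 * t)) ≤ z := by
    have hω := volumeReal_ball_pos (E := E)
    set ω := volume.real (Metric.ball (0 : E) 1) with hωd
    have hd := diffMeasure_shell_le hs hs1 hp.le hu MeasurableSet.univ convex_univ
      (by positivity : 0 < 8 * t)
    rw [univ_prod_univ] at hd
    rw [hAt, volume_ball_eq _ ht.le, ← hωd, ← ENNReal.ofReal_inv_of_pos (by positivity),
      ← ENNReal.ofReal_inv_of_pos (by positivity), ← ENNReal.ofReal_mul (by positivity)]
    refine (mul_le_mul_right hd _).trans ?_
    rw [← mul_assoc, ← ENNReal.ofReal_mul (by positivity)]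
    refine mul_le_mul_left (ENNReal.ofReal_le_ofReal ?_) _
    rw [← mul_assoc 2 8]
    refine (scale_const_le (C := ω) hs hs1 hp.le ht (by norm_num) (by norm_num) ?_ hω).trans ?_
    · exact le_of_eq (by ring)
    · have k1 : p * 16 ^ (n + p) * (1 / ω) ≤ ballConst E p := by
        rw [ballConst, ← hωd, ← hn]
        gcongr
        have : 0 < 1 / ω ^ 2 := by positivity
        linarith
      -- This factor is at least 1, so the translation error is also bounded by z. The sum is then 2
      -- z^(1/p), whence the 2^p in `weakConst`.
      have k2 : 1 ≤ 2 * (2 * (p - 1 + n)) ^ (p - 1) / (n - s * p) ^ (p - 1) := by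
        rw [one_le_div (by positivity)]
        have : (n - s * p) ^ (p - 1) ≤ (2 * (p - 1 + n)) ^ (p - 1) :=
          Real.rpow_le_rpow hns.le (by nlinarith) hp1.le
        have : 0 < (2 * (p - 1 + n)) ^ (p - 1) := by positivity
        linarith
      calc _ ≤ ballConst E p * (1 - s) * t ^ (-(n - s * p)) := by gcongr
        _ ≤ ballConst E p * (1 - s) * t ^ (-(n - s * p)) *
            (2 * (2 * (p - 1 + n)) ^ (p - 1) / (n - s * p) ^ (p - 1)) :=
          le_mul_of_one_le_right (by positivity) k2
        _ = _ := by rw [meanConst]; ring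
  have h4 : lpMean p u A ≤ 2 * z ^ (1 / p) := by
    rw [two_mul]
    exact h2.trans (add_le_add le_rfl (ENNReal.rpow_le_rpow h3 (by positivity)))
  refine h1.trans ((ENNReal.rpow_le_rpow h4 (by linarith)).trans (le_of_eq ?_))
  rw [ENNReal.mul_rpow_of_nonneg _ _ (by linarith), ← ENNReal.rpow_mul,
    one_div_mul_cancel (by linarith), ENNReal.rpow_one, hz, ← mul_assoc, ← ENNReal.ofReal_ofNat 2,
    ENNReal.ofReal_rpow_of_pos two_pos, ← ENNReal.ofReal_mul (by positivity), weakConst]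
  congr 2
  ring

/-- The weak-type fractional Sobolev inequality. -/
lemma rpow_mul_volume_rpow_le [Nontrivial E] {s p : ℝ} (hs : 0 ≤ s) (hs1 : s < 1) (hp : 1 < p)
    (hsp : s * p < finrank ℝ E) {u : E → ℝ} (hu : Measurable u) (hup : ∫⁻ x, ‖u x‖ₑ ^ p ≠ ∞)
    {A : Set E} (hA : MeasurableSet A) (hA1 : volume A ≠ ∞) {lam : ℝ≥0∞}
    (hlam : ∀ x ∈ A, lam ≤ ‖u x‖ₑ) :
    lam ^ p * volume A ^ (1 - s * p / finrank ℝ E) ≤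
      ENNReal.ofReal (weakConst E p * ((1 - s) / ((finrank ℝ E : ℝ) - s * p) ^ (p - 1))) *
        gagliardoMeasure s p u univ := by
  have hn0 : 0 < finrank ℝ E := finrank_pos
  set n : ℝ := (finrank ℝ E : ℝ) with hn
  have hn1 : 0 < n := by rw [hn]; exact_mod_cast hn0
  have hns : 0 < n - s * p := by linarith
  have hC := weakConst_pos (E := E) hp
  have h1s : 0 < 1 - s := by linarith
  rcases eq_or_ne (volume A) 0 with hA0 | hA0
  · have : 0 < 1 - s * p / n := by rw [sub_pos, div_lt_one hn1]; exact hsp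
    rw [hA0, ENNReal.zero_rpow_of_pos this, mul_zero]
    exact zero_le
  have hm : 0 < (volume A).toReal := ENNReal.toReal_pos hA0 hA1
  set m := (volume A).toReal with hmd
  have hAm : volume A = ENNReal.ofReal m := (ENNReal.ofReal_toReal hA1).symm
  set t := m ^ (1 / n) with ht
  have ht0 : 0 < t := by positivity
  have htn : t ^ finrank ℝ E = m := by
    rw [ht, ← Real.rpow_natCast, ← Real.rpow_mul hm.le, one_div_mul_cancel hn1.ne', Real.rpow_one]
  have h := rpow_le_of_le_enorm hs hs1 hp hsp hu hup hA ht0 (by rw [htn, hAm]) hlam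
  have e1 : t ^ (-(n - s * p)) = (m ^ (1 - s * p / n))⁻¹ := by
    rw [ht, ← Real.rpow_mul hm.le, ← Real.rpow_neg hm.le]
    congr 1
    field_simp
  rw [hAm, ENNReal.ofReal_rpow_of_pos hm]
  refine (mul_le_mul_left h _).trans (le_of_eq ?_)
  rw [mul_right_comm, ← ENNReal.ofReal_mul (by positivity), e1, mul_assoc (weakConst E p * _),
    inv_mul_cancel₀ (by positivity), mul_one]

end General

/-! ### Power sums and telescoping over the integers. -/

section Sums

lemma sum_rpow_le_rpow_sum {ι : Type*} {p : ℝ} (hp : 1 ≤ p) (s : Finset ι) (f : ι → ℝ≥0∞) :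
    ∑ i ∈ s, f i ^ p ≤ (∑ i ∈ s, f i) ^ p := by
  classical
  induction s using Finset.induction_on with
  | empty => simp
  | insert i s hi ih =>
    rw [Finset.sum_insert hi, Finset.sum_insert hi]
    exact (add_le_add le_rfl ih).trans (ENNReal.add_rpow_le_rpow_add _ _ hp)

lemma tsum_le_of_finset_sum_le {ι : Type*} {f : ι → ℝ≥0∞} {c : ℝ≥0∞}
    (h : ∀ s : Finset ι, ∑ i ∈ s, f i ≤ c) : ∑' i, f i ≤ c := by
  rw [ENNReal.tsum_eq_iSup_sum]
  exact iSup_le h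

lemma tsum_rpow_le_rpow_tsum {ι : Type*} {p : ℝ} (hp : 1 ≤ p) (f : ι → ℝ≥0∞) :
    ∑' i, f i ^ p ≤ (∑' i, f i) ^ p :=
  tsum_le_of_finset_sum_le fun s => (sum_rpow_le_rpow_sum hp s f).trans
    (ENNReal.rpow_le_rpow (ENNReal.sum_le_tsum s) (by linarith))

lemma rpow_tsum_le_tsum_rpow {ι : Type*} {q : ℝ} (hq : 0 < q) (hq1 : q ≤ 1) (f : ι → ℝ≥0∞) :
    (∑' i, f i) ^ q ≤ ∑' i, f i ^ q := by
  have h := tsum_rpow_le_rpow_tsum (one_le_one_div hq hq1) fun i => f i ^ q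
  have e : ∀ i, (f i ^ q) ^ (1 / q) = f i := fun i => by
    rw [← ENNReal.rpow_mul, mul_one_div_cancel hq.ne', ENNReal.rpow_one]
  simp only [e] at h
  have h' := ENNReal.rpow_le_rpow h hq.le
  rwa [← ENNReal.rpow_mul, one_div_mul_cancel hq.ne', ENNReal.rpow_one] at h'

lemma sum_sub_le_of_monotone {G : ℤ → ℝ} (hG : Monotone G) {D : ℝ} (h0 : ∀ k, 0 ≤ G k)
    (hD : ∀ k, G k ≤ D) (s : Finset ℤ) : ∑ k ∈ s, (G (k + 1) - G k) ≤ D := by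
  have aux : ∀ (m : ℤ) (N : ℕ), ∑ k ∈ Finset.Ico m (m + N), (G (k + 1) - G k) = G (m + N) - G m := by
    intro m N
    induction N with
    | zero => simp
    | succ N ih =>
      have : Finset.Ico m (m + (N + 1 : ℕ)) = insert (m + N) (Finset.Ico m (m + N)) := by
        ext k; simp only [Finset.mem_Ico, Finset.mem_insert]; push_cast; omega
      rw [this, Finset.sum_insert (by simp), ih]
      push_cast
      rw [add_assoc]; ring
  obtain ⟨m, hm⟩ := s.bddBelow
  obtain ⟨M, hM⟩ := s.bddAbove
  have hsub : s ⊆ Finset.Ico m (m + ((M + 1 - m).toNat : ℤ)) := by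
    intro k hk
    have h1 := hm hk
    have h2 := hM hk
    rw [Finset.mem_Ico]
    omega
  refine (Finset.sum_le_sum_of_subset_of_nonneg hsub fun k _ _ => ?_).trans ?_
  · exact sub_nonneg.2 (hG (by omega))
  · rw [aux]
    linarith [hD (m + ((M + 1 - m).toNat : ℤ)), h0 m]

end Sums

/-! ### Dyadic truncation of |u|. -/

section Truncation

variable {X : Type*}

/-- The part of `|u|` between the levels `2^k` and `2^(k+1)`. -/
noncomputable def trunc (u : X → ℝ) (k : ℤ) (x : X) : ℝ :=
  min |u x| (2 ^ (k + 1)) - min |u x| (2 ^ k)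

/-- The level set `{|u| ≥ 2^k}`. -/
def levelSet (u : X → ℝ) (k : ℤ) : Set X := {x | (2 : ℝ) ^ k ≤ |u x|}

lemma two_zpow_le_succ (k : ℤ) : (2 : ℝ) ^ k ≤ 2 ^ (k + 1) :=
  zpow_le_zpow_right₀ (by norm_num) (by omega)

lemma trunc_of_mem (u : X → ℝ) {k : ℤ} {x : X} (hx : x ∈ levelSet u (k + 1)) :
    trunc u k x = 2 ^ k := by
  have h1 : (2 : ℝ) ^ (k + 1) ≤ |u x| := hx
  rw [trunc, min_eq_right h1, min_eq_right ((two_zpow_le_succ k).trans h1),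
    zpow_add_one₀ two_ne_zero]
  ring

lemma trunc_of_notMem (u : X → ℝ) {k : ℤ} {x : X} (hx : x ∉ levelSet u k) :
    trunc u k x = 0 := by
  have h1 : |u x| < (2 : ℝ) ^ k := not_le.1 hx
  rw [trunc, min_eq_left h1.le, min_eq_left (h1.le.trans (two_zpow_le_succ k)), sub_self]

lemma abs_trunc_le (u : X → ℝ) (k : ℤ) (x : X) : |trunc u k x| ≤ |u x| := by
  have h1 : min |u x| ((2 : ℝ) ^ k) ≤ min |u x| (2 ^ (k + 1)) :=
    min_le_min le_rfl (two_zpow_le_succ k)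
  have h2 : 0 ≤ min |u x| ((2 : ℝ) ^ k) := le_min (abs_nonneg _) (by positivity)
  rw [trunc, abs_of_nonneg (by linarith)]
  linarith [min_le_left |u x| ((2 : ℝ) ^ (k + 1))]

lemma measurable_trunc [MeasurableSpace X] {u : X → ℝ} (hu : Measurable u) (k : ℤ) :
    Measurable (trunc u k) :=
  (hu.abs.min measurable_const).sub (hu.abs.min measurable_const)

lemma measurableSet_levelSet [MeasurableSpace X] {u : X → ℝ} (hu : Measurable u) (k : ℤ) :
    MeasurableSet (levelSet u k) := measurableSet_le measurable_const hu.abs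

/-- For |u y| ≤ |u x| the differences of the truncations are increments of a monotone function with
values in [0, |u x| - |u y|]. Their sum is thus at most |u x - u y|, and a sum of p-th powers is at
most the p-th power of the sum. -/
lemma tsum_trunc_le {p : ℝ} (hp : 1 ≤ p) (u : X → ℝ) (x y : X) :
    ∑' k, ‖trunc u k x - trunc u k y‖ₑ ^ p ≤ ‖u x - u y‖ₑ ^ p := by
  wlog hxy : |u y| ≤ |u x| generalizing x y
  · have h := this y x (le_of_not_ge hxy)
    have e : ∀ a b : ℝ, ‖a - b‖ₑ = ‖b - a‖ₑ := fun a b => by rw [← enorm_neg, neg_sub]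
    simpa only [e (u y), e (trunc u _ y)] using h
  set G : ℤ → ℝ := fun k => min |u x| (2 ^ k) - min |u y| (2 ^ k) with hG
  have hmono : Monotone G := by
    intro i j hij
    have h1 : (2 : ℝ) ^ i ≤ 2 ^ j := zpow_le_zpow_right₀ (by norm_num) hij
    simp only [hG]
    rcases le_total |u x| ((2 : ℝ) ^ i) with a | a <;> rcases le_total |u y| ((2 : ℝ) ^ i) with b | b
      <;> rcases le_total |u x| ((2 : ℝ) ^ j) with c | c
      <;> rcases le_total |u y| ((2 : ℝ) ^ j) with d | d <;> simp only [min_eq_left, min_eq_right, *]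
      <;> linarith
  have h0 : ∀ k, 0 ≤ G k := fun k => sub_nonneg.2 (min_le_min hxy le_rfl)
  have hD : ∀ k, G k ≤ |u x| - |u y| := by
    intro k
    simp only [hG]
    rcases le_total |u x| ((2 : ℝ) ^ k) with a | a <;> rcases le_total |u y| ((2 : ℝ) ^ k) with b | b
      <;> simp only [min_eq_left, min_eq_right, *] <;> linarith
  have e1 : ∀ k, trunc u k x - trunc u k y = G (k + 1) - G k := by
    intro k; simp only [trunc, hG]; ring
  refine tsum_le_of_finset_sum_le fun s => (sum_rpow_le_rpow_sum hp s _).trans ?_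
  refine ENNReal.rpow_le_rpow ?_ (by linarith)
  have e2 : ∀ k, ‖trunc u k x - trunc u k y‖ₑ = ENNReal.ofReal (G (k + 1) - G k) := by
    intro k
    rw [e1, Real.enorm_of_nonneg (sub_nonneg.2 (hmono (by omega)))]
  simp only [e2]
  rw [← ENNReal.ofReal_sum_of_nonneg fun k _ => sub_nonneg.2 (hmono (by omega)),
    ← ofReal_norm]
  exact ENNReal.ofReal_le_ofReal ((sum_sub_le_of_monotone hmono h0 hD s).trans
    (abs_sub_abs_le_abs_sub _ _))

end Truncation

/-! ### Level sums and Lebesgue norms. -/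

section LevelSum

variable {X : Type*} [MeasurableSpace X] {μ : Measure X}

lemma ofReal_two_zpow (k : ℤ) : ENNReal.ofReal ((2 : ℝ) ^ k) = 2 ^ (k : ℝ) := by
  rw [← Real.rpow_intCast, ← ENNReal.ofReal_rpow_of_pos two_pos, ENNReal.ofReal_ofNat]

/-- The sum of `2^(k p) |{|u| ≥ 2^k}|^q` over all integers `k`. -/
noncomputable def levelSum (μ : Measure X) (p q : ℝ) (u : X → ℝ) : ℝ≥0∞ :=
  ∑' k : ℤ, ((2 : ℝ≥0∞) ^ (k : ℝ)) ^ p * μ (levelSet u k) ^ q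

lemma le_enorm_of_mem_levelSet {u : X → ℝ} {k : ℤ} {x : X} (hx : x ∈ levelSet u k) :
    (2 : ℝ≥0∞) ^ (k : ℝ) ≤ ‖u x‖ₑ := by
  rw [← ofReal_two_zpow, ← ofReal_norm]
  exact ENNReal.ofReal_le_ofReal hx

lemma measure_levelSet_ne_top {p : ℝ} (hp : 0 < p) {u : X → ℝ}
    (hup : ∫⁻ x, ‖u x‖ₑ ^ p ∂μ ≠ ∞) (k : ℤ) (hu : Measurable u) : μ (levelSet u k) ≠ ∞ := by
  have hc0 : ((2 : ℝ≥0∞) ^ (k : ℝ)) ^ p ≠ 0 :=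
    (ENNReal.rpow_pos (ENNReal.rpow_pos two_pos (by finiteness)) (by finiteness)).ne'
  have hc1 : ((2 : ℝ≥0∞) ^ (k : ℝ)) ^ p ≠ ∞ := by finiteness
  have h := meas_ge_le_lintegral_div (μ := μ) (hu.enorm.pow_const p).aemeasurable hc0 hc1
  refine ne_top_of_le_ne_top (ENNReal.div_ne_top hup hc0) (le_trans (measure_mono ?_) h)
  intro x hx
  exact ENNReal.rpow_le_rpow (le_enorm_of_mem_levelSet hx) hp.le

lemma lintegral_rpow_le_tsum {P : ℝ} (hP : 0 < P) {u : X → ℝ} (hu : Measurable u) :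
    ∫⁻ x, ‖u x‖ₑ ^ P ∂μ ≤ ∑' k : ℤ, (2 * (2 : ℝ≥0∞) ^ (k : ℝ)) ^ P * μ (levelSet u k) := by
  have hpt : ∀ x, ‖u x‖ₑ ^ P ≤ ∑' k : ℤ, (levelSet u k).indicator
      (fun _ => (2 * (2 : ℝ≥0∞) ^ (k : ℝ)) ^ P) x := by
    intro x
    rcases eq_or_ne (u x) 0 with h | h
    · rw [h, enorm_zero, ENNReal.zero_rpow_of_pos hP]; exact zero_le
    obtain ⟨k, hk1, hk2⟩ := exists_mem_Ico_zpow (abs_pos.2 h) (one_lt_two (α := ℝ))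
    refine le_trans ?_ (ENNReal.le_tsum k)
    rw [indicator_of_mem (show x ∈ levelSet u k from hk1)]
    refine ENNReal.rpow_le_rpow ?_ hP.le
    rw [← ofReal_two_zpow, ← ENNReal.ofReal_ofNat 2, ← ENNReal.ofReal_mul two_pos.le, ← ofReal_norm,
      mul_comm, ← zpow_add_one₀ two_ne_zero]
    exact ENNReal.ofReal_le_ofReal hk2.le
  refine (lintegral_mono hpt).trans (le_of_eq ?_)
  rw [lintegral_tsum fun k =>
    (measurable_const.indicator (measurableSet_levelSet hu k)).aemeasurable]
  congr 1 with k
  rw [lintegral_indicator (measurableSet_levelSet hu k), setLIntegral_const]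

/-- The layer-cake sum dominates the integral, and the power p/P ≤ 1 may be moved inside the sum. -/
lemma rpow_lintegral_le_levelSum {p P : ℝ} (hp : 0 < p) (hP : p ≤ P) {u : X → ℝ}
    (hu : Measurable u) :
    (∫⁻ x, ‖u x‖ₑ ^ P ∂μ) ^ (p / P) ≤ 2 ^ p * levelSum μ p (p / P) u := by
  have hP0 : 0 < P := hp.trans_le hP
  refine (ENNReal.rpow_le_rpow (lintegral_rpow_le_tsum hP0 hu) (by positivity)).trans ?_
  refine (rpow_tsum_le_tsum_rpow (by positivity) ((div_le_one hP0).2 hP) _).trans (le_of_eq ?_)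
  rw [levelSum, ← ENNReal.tsum_mul_left]
  congr 1 with k
  rw [ENNReal.mul_rpow_of_nonneg _ _ (by positivity), ← ENNReal.rpow_mul,
    mul_div_cancel₀ _ hP0.ne', ENNReal.mul_rpow_of_nonneg _ _ hp.le, mul_assoc]

end LevelSum

/-! ### From weak type to strong type, the factor s, and the Sobolev inequality. -/

section General

variable {E : Type*} [NormedAddCommGroup E] [NormedSpace ℝ E] [FiniteDimensional ℝ E]
  [MeasureSpace E] [BorelSpace E] [(volume : Measure E).IsAddHaarMeasure]

lemma tsum_gagliardoMeasure_trunc_le {s p : ℝ} (hp : 1 ≤ p) {u : E → ℝ} (hu : Measurable u) :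
    ∑' k, gagliardoMeasure s p (trunc u k) univ ≤ gagliardoMeasure s p u univ := by
  simp only [gagliardoMeasure, withDensity_apply _ MeasurableSet.univ, Measure.restrict_univ]
  have hm : ∀ k, Measurable fun z : E × E => ‖trunc u k z.1 - trunc u k z.2‖ₑ ^ p *
      ENNReal.ofReal (1 / ‖z.1 - z.2‖ ^ ((finrank ℝ E : ℝ) + s * p)) := fun k =>
    (measurable_diff (measurable_trunc hu k)).mul (measurable_gagliardo_kernel _)
  rw [← lintegral_tsum fun k => (hm k).aemeasurable]
  refine lintegral_mono fun z => ?_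
  rw [ENNReal.tsum_mul_right]
  gcongr
  exact tsum_trunc_le hp u z.1 z.2

lemma lintegral_trunc_ne_top {p : ℝ} (hp : 0 ≤ p) {u : E → ℝ} (hup : ∫⁻ x, ‖u x‖ₑ ^ p ≠ ∞)
    (k : ℤ) : ∫⁻ x, ‖trunc u k x‖ₑ ^ p ≠ ∞ := by
  refine ne_top_of_le_ne_top hup (lintegral_mono fun x => ENNReal.rpow_le_rpow ?_ hp)
  rw [← ofReal_norm, ← ofReal_norm]
  exact ENNReal.ofReal_le_ofReal (abs_trunc_le u k x)

lemma levelSum_succ (p q : ℝ) (u : E → ℝ) :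
    levelSum volume p q u =
      2 ^ p * ∑' k : ℤ, ((2 : ℝ≥0∞) ^ (k : ℝ)) ^ p * volume (levelSet u (k + 1)) ^ q := by
  rw [levelSum, ← (Equiv.addRight (1 : ℤ)).tsum_eq, ← ENNReal.tsum_mul_left]
  congr 1 with k
  rw [Equiv.coe_addRight, Int.cast_add, Int.cast_one,
    ENNReal.rpow_add _ _ two_ne_zero ENNReal.ofNat_ne_top, ENNReal.rpow_one, ← mul_assoc,
    ENNReal.mul_rpow_of_ne_top (by finiteness) (by finiteness), mul_comm (2 ^ p)]

/-- The level sum is controlled by the Gagliardo seminorm, with the constant that is sharp as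
`s → 1` and as `s p → n`. -/
lemma levelSum_le_one_sub [Nontrivial E] {s p : ℝ} (hs : 0 ≤ s) (hs1 : s < 1) (hp : 1 < p)
    (hsp : s * p < finrank ℝ E) {u : E → ℝ} (hu : Measurable u) (hup : ∫⁻ x, ‖u x‖ₑ ^ p ≠ ∞) :
    levelSum volume p (1 - s * p / finrank ℝ E) u ≤
      ENNReal.ofReal (2 ^ p * weakConst E p *
        ((1 - s) / ((finrank ℝ E : ℝ) - s * p) ^ (p - 1))) * gagliardoMeasure s p u univ := by
  rw [levelSum_succ, mul_assoc (2 ^ p : ℝ), ENNReal.ofReal_mul (by positivity),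
    ← ENNReal.ofReal_rpow_of_pos two_pos, ENNReal.ofReal_ofNat, mul_assoc (2 ^ p : ℝ≥0∞)]
  gcongr
  refine le_trans ?_ (mul_le_mul_right (tsum_gagliardoMeasure_trunc_le hp.le hu) _)
  rw [← ENNReal.tsum_mul_left]
  refine ENNReal.tsum_le_tsum fun k => ?_
  -- The weak-type inequality is applied to `trunc u k` at height 2^k, which it attains on `levelSet
  -- u (k + 1)`.
  refine rpow_mul_volume_rpow_le hs hs1 hp hsp (measurable_trunc hu k)
    (lintegral_trunc_ne_top (by linarith) hup k) (measurableSet_levelSet hu _)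
    (measure_levelSet_ne_top (by linarith) hup _ hu) fun x hx => ?_
  rw [trunc_of_mem u hx, ← ofReal_two_zpow, Real.enorm_of_nonneg (by positivity)]

/-- The annulus has volume (2^n - 1) ω ρ^n ≥ ω ρ^n, and A removes at most half of ω ρ^n. -/
lemma volume_annulus_diff_ge [Nontrivial E] (x : E) {A : Set E} {m ρ : ℝ}
    (hm : 0 ≤ m) (hρ : 0 < ρ) (hAm : volume A = ENNReal.ofReal m)
    (hmρ : m ≤ 1 / 2 * (ρ ^ finrank ℝ E * volume.real (Metric.ball (0 : E) 1))) :
    ENNReal.ofReal (1 / 2 * (ρ ^ finrank ℝ E * volume.real (Metric.ball (0 : E) 1))) ≤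
      volume ({y | ρ ≤ ‖x - y‖ ∧ ‖x - y‖ < 2 * ρ} ∩ Aᶜ) := by
  have hω := volumeReal_ball_pos (E := E)
  set ω := volume.real (Metric.ball (0 : E) 1) with hωd
  have hsub : Metric.ball x (2 * ρ) \ (Metric.ball x ρ ∪ A) ⊆
      {y | ρ ≤ ‖x - y‖ ∧ ‖x - y‖ < 2 * ρ} ∩ Aᶜ := by
    rintro y ⟨h1, h2⟩
    rw [mem_union, not_or] at h2
    rw [Metric.mem_ball, dist_comm, dist_eq_norm] at h1
    refine ⟨⟨?_, h1⟩, h2.2⟩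
    have := h2.1
    rwa [Metric.mem_ball, dist_comm, dist_eq_norm, not_lt] at this
  refine le_trans ?_ ((le_measure_sdiff (μ := volume)).trans (measure_mono hsub))
  refine le_trans ?_ (tsub_le_tsub_left (measure_union_le _ _) _)
  rw [volume_ball_eq _ hρ.le, volume_ball_eq _ (by positivity), hAm,
    ← ENNReal.ofReal_add (by positivity) hm, ← ENNReal.ofReal_sub _ (by positivity), ← hωd]
  refine ENNReal.ofReal_le_ofReal ?_
  have h2 : (2 : ℝ) ≤ 2 ^ finrank ℝ E :=
    le_self_pow₀ (by norm_num) (finrank_pos (R := ℝ) (M := E)).ne'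
  rw [mul_pow]
  have : 0 < ρ ^ finrank ℝ E * ω := by positivity
  nlinarith

/-- The constant in the lower bound for the interaction of a point with the complement of a set. -/
noncomputable def farConst (E : Type*) [NormedAddCommGroup E] [NormedSpace ℝ E] [MeasureSpace E]
    (p : ℝ) : ℝ :=
  1 / 2 * volume.real (Metric.ball (0 : E) 1) * (2 ^ ((finrank ℝ E : ℝ) + p))⁻¹ *
    min 1 (volume.real (Metric.ball (0 : E) 1) / 2) / p

lemma farConst_pos {p : ℝ} (hp : 0 < p) : 0 < farConst E p := by
  have := volumeReal_ball_pos (E := E)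
  unfold farConst
  positivity

/-- Outside a ball of volume 2|A|, each dyadic annulus of radius 2^j R contributes at least a
multiple of (2^j R)^(-sp). The geometric series in j produces 1/(sp). -/
lemma le_setLIntegral_compl [Nontrivial E] {s p : ℝ} (hs : 0 < s) (hs1 : s < 1) (hp : 0 < p)
    (hsp : s * p < finrank ℝ E) (x : E) {A : Set E} (hA : MeasurableSet A) (hA0 : volume A ≠ 0)
    (hA1 : volume A ≠ ∞) :
    ENNReal.ofReal (farConst E p / s) * volume A ^ (-(s * p / finrank ℝ E)) ≤
      ∫⁻ y in Aᶜ, ENNReal.ofReal (1 / ‖x - y‖ ^ ((finrank ℝ E : ℝ) + s * p)) := by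
  have hω := volumeReal_ball_pos (E := E)
  have hn0 : 0 < finrank ℝ E := finrank_pos
  set d := finrank ℝ E with hd
  set n : ℝ := (d : ℝ) with hn
  have hn1 : 0 < n := by rw [hn]; exact_mod_cast hn0
  set m := (volume A).toReal with hmd
  have hm : 0 < m := ENNReal.toReal_pos hA0 hA1
  have hAm : volume A = ENNReal.ofReal m := (ENNReal.ofReal_toReal hA1).symm
  set ω := volume.real (Metric.ball (0 : E) 1) with hωd
  set R : ℝ := (2 * m / ω) ^ (1 / n) with hR
  have hR0 : 0 < R := by positivity
  have hRn : R ^ d = 2 * m / ω := by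
    rw [hR, ← Real.rpow_natCast, ← Real.rpow_mul (by positivity), one_div_mul_cancel hn1.ne',
      Real.rpow_one]
  set K : E → ℝ≥0∞ := fun y => ENNReal.ofReal (1 / ‖x - y‖ ^ (n + s * p)) with hK
  set S : ℕ → Set E := fun j => {y | 2 ^ j * R ≤ ‖x - y‖ ∧ ‖x - y‖ < 2 * (2 ^ j * R)} with hS
  have hnm : Measurable fun y => ‖x - y‖ := by fun_prop
  have hSm : ∀ j, MeasurableSet (S j) := fun j =>
    (measurableSet_le measurable_const hnm).inter (measurableSet_lt hnm measurable_const)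
  have hdisj : Pairwise (Function.onFun (AEDisjoint ((volume.restrict Aᶜ).withDensity K)) S) := by
    have aux : ∀ i j : ℕ, i < j → Disjoint (S i) (S j) := by
      intro i j hij
      rw [Set.disjoint_left]
      rintro y ⟨-, h1⟩ ⟨h2, -⟩
      obtain ⟨l, rfl⟩ := Nat.exists_eq_add_of_lt hij
      have h3 : (1 : ℝ) ≤ 2 ^ l := one_le_pow₀ (by norm_num)
      rw [pow_succ, pow_add] at h2
      have : 0 < 2 ^ i * R := by positivity
      nlinarith
    intro i j hij
    rcases lt_or_gt_of_ne hij with h | h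
    · exact (aux i j h).aedisjoint
    · exact (aux j i h).symm.aedisjoint
  have hsum := tsum_measure_le_measure_univ (fun j => (hSm j).nullMeasurableSet) hdisj
  rw [withDensity_apply _ MeasurableSet.univ, Measure.restrict_univ] at hsum
  refine le_trans ?_ hsum
  set x₀ := s * p with hx₀
  have hx₀' : 0 < x₀ := by positivity
  set b : ℝ := 1 / 2 * ω * (2 ^ (n + x₀))⁻¹ * R ^ (-x₀) with hb
  have hj : ∀ j, ENNReal.ofReal b * ENNReal.ofReal ((2 : ℝ) ^ (-x₀)) ^ j ≤
      ((volume.restrict Aᶜ).withDensity K) (S j) := by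
    intro j
    set ρ := 2 ^ j * R with hρ
    have hρ0 : 0 < ρ := by positivity
    have hvol := volume_annulus_diff_ge x hm.le hρ0 hAm (by
      rw [← hd, ← hωd, hρ, mul_pow, hRn]
      have : (1 : ℝ) ≤ (2 ^ j) ^ d := one_le_pow₀ (one_le_pow₀ (by norm_num))
      have e : 1 / 2 * ((2 ^ j) ^ d * (2 * m / ω) * ω) = (2 ^ j) ^ d * m := by field_simp
      rw [e]
      nlinarith)
    rw [← hd, ← hωd] at hvol
    rw [withDensity_apply _ (hSm j), Measure.restrict_restrict (hSm j)]
    have hlow : ENNReal.ofReal (1 / (2 * ρ) ^ (n + x₀)) * volume (S j ∩ Aᶜ) ≤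
        ∫⁻ y in S j ∩ Aᶜ, K y := by
      rw [← setLIntegral_const]
      refine setLIntegral_mono' ((hSm j).inter hA.compl) fun y hy => ?_
      have hy1 : ρ ≤ ‖x - y‖ := hy.1.1
      have hy2 : ‖x - y‖ < 2 * ρ := hy.1.2
      have : 0 < ‖x - y‖ := hρ0.trans_le hy1
      refine ENNReal.ofReal_le_ofReal (one_div_le_one_div_of_le (by positivity) ?_)
      exact Real.rpow_le_rpow this.le hy2.le (by positivity)
    refine le_trans ?_ ((mul_le_mul_right hvol _).trans hlow)
    rw [← ENNReal.ofReal_pow (by positivity), ← ENNReal.ofReal_mul (by positivity),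
      ← ENNReal.ofReal_mul (by positivity)]
    refine ENNReal.ofReal_le_ofReal (le_of_eq ?_)
    have e1 : (2 * ρ) ^ (n + x₀) = 2 ^ (n + x₀) * (ρ ^ d * ρ ^ x₀) := by
      rw [Real.mul_rpow two_pos.le hρ0.le, Real.rpow_add hρ0, hn, Real.rpow_natCast]
    have e2 : ((2 : ℝ) ^ (-x₀)) ^ j * R ^ (-x₀) = (ρ ^ x₀)⁻¹ := by
      rw [hρ, ← Real.rpow_neg (by positivity), Real.mul_rpow (by positivity) hR0.le,
        ← Real.rpow_natCast, ← Real.rpow_natCast, ← Real.rpow_mul two_pos.le,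
        ← Real.rpow_mul two_pos.le, mul_comm (j : ℝ)]
    calc _ = 1 / 2 * ω * (2 ^ (n + x₀))⁻¹ * (((2 : ℝ) ^ (-x₀)) ^ j * R ^ (-x₀)) := by
          rw [hb]; ring
      _ = _ := by rw [e2, e1]; field_simp
  refine le_trans ?_ (ENNReal.tsum_le_tsum hj)
  rw [ENNReal.tsum_mul_left, ENNReal.tsum_geometric]
  have hlt : (2 : ℝ) ^ (-x₀) < 1 := Real.rpow_lt_one_of_one_lt_of_neg (by norm_num) (by linarith)
  rw [← ENNReal.ofReal_one, ← ENNReal.ofReal_sub _ (by positivity),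
    ← ENNReal.ofReal_inv_of_pos (by linarith), ← ENNReal.ofReal_mul (by positivity), hAm,
    ENNReal.ofReal_rpow_of_pos hm,
    ← ENNReal.ofReal_mul (div_nonneg (farConst_pos hp).le hs.le)]
  refine ENNReal.ofReal_le_ofReal ?_
  have h1 : x₀⁻¹ ≤ (1 - (2 : ℝ) ^ (-x₀))⁻¹ :=
    inv_anti₀ (by linarith) (one_le_one_sub_two_rpow_neg hx₀')
  have h2 : (2 ^ (n + p))⁻¹ ≤ ((2 : ℝ) ^ (n + x₀))⁻¹ := by
    refine inv_anti₀ (by positivity) (Real.rpow_le_rpow_of_exponent_le (by norm_num) ?_)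
    nlinarith
  -- The exponent sp/n lies in (0, 1], which makes the constant independent of s.
  have h3 : min 1 (ω / 2) * m ^ (-(x₀ / n)) ≤ R ^ (-x₀) := by
    have e3 : R ^ (-x₀) = (ω / 2) ^ (x₀ / n) * m ^ (-(x₀ / n)) := by
      rw [hR, ← Real.rpow_mul (by positivity)]
      have : 1 / n * -x₀ = -(x₀ / n) := by ring
      rw [this, Real.rpow_neg (by positivity), ← Real.inv_rpow (by positivity), Real.rpow_neg hm.le,
        ← Real.inv_rpow hm.le, ← Real.mul_rpow (by positivity) (by positivity)]
      congr 1
      field_simp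
    rw [e3]
    gcongr
    have h4 : x₀ / n ≤ 1 := (div_le_one hn1).2 hsp.le
    calc min 1 (ω / 2) = min 1 (ω / 2) ^ (1 : ℝ) := (Real.rpow_one _).symm
      _ ≤ min 1 (ω / 2) ^ (x₀ / n) :=
          Real.rpow_le_rpow_of_exponent_ge (by positivity) (min_le_left _ _) h4
      _ ≤ _ := Real.rpow_le_rpow (by positivity) (min_le_right _ _) (by positivity)
  calc _ = 1 / 2 * ω * (2 ^ (n + p))⁻¹ * (min 1 (ω / 2) * m ^ (-(x₀ / n))) * x₀⁻¹ := by
        rw [farConst, ← hd, ← hn, ← hωd, hx₀]; field_simp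
    _ ≤ 1 / 2 * ω * (2 ^ (n + x₀))⁻¹ * R ^ (-x₀) * (1 - (2 : ℝ) ^ (-x₀))⁻¹ := by gcongr
    _ = _ := by rw [hb]

lemma levelSet_succ_subset {X : Type*} (u : X → ℝ) (k : ℤ) :
    levelSet u (k + 1) ⊆ levelSet u k := fun _ hx => (two_zpow_le_succ k).trans hx

/-- Only pairs with x in `levelSet u (k + 1)` and y outside `levelSet u k` are kept; there the
truncation jumps by exactly 2^k. -/
lemma le_gagliardoMeasure_trunc [Nontrivial E] {s p : ℝ} (hs : 0 < s) (hs1 : s < 1) (hp : 1 < p)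
    (hsp : s * p < finrank ℝ E) {u : E → ℝ} (hu : Measurable u) (hup : ∫⁻ x, ‖u x‖ₑ ^ p ≠ ∞)
    (k : ℤ) :
    ENNReal.ofReal (farConst E p / s) * (((2 : ℝ≥0∞) ^ (k : ℝ)) ^ p *
      (volume (levelSet u (k + 1)) * volume (levelSet u k) ^ (-(s * p / finrank ℝ E)))) ≤
      gagliardoMeasure s p (trunc u k) univ := by
  rcases eq_or_ne (volume (levelSet u k)) 0 with h0 | h0
  · rw [measure_mono_null (levelSet_succ_subset u k) h0]
    simp
  have hA1 := measure_levelSet_ne_top (by linarith) hup k hu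
  have hAm := measurableSet_levelSet hu k
  set A := levelSet u k
  set B := levelSet u (k + 1) with hB
  have hBm : MeasurableSet B := measurableSet_levelSet hu (k + 1)
  have hm : Measurable fun z : E × E => ‖trunc u k z.1 - trunc u k z.2‖ₑ ^ p *
      ENNReal.ofReal (1 / ‖z.1 - z.2‖ ^ ((finrank ℝ E : ℝ) + s * p)) :=
    (measurable_diff (measurable_trunc hu k)).mul (measurable_gagliardo_kernel _)
  rw [gagliardoMeasure, withDensity_apply _ MeasurableSet.univ, Measure.restrict_univ,
    Measure.volume_eq_prod, lintegral_prod _ hm.aemeasurable]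
  refine le_trans ?_ (setLIntegral_le_lintegral B _)
  have hx : ∀ x ∈ B, ENNReal.ofReal (farConst E p / s) * (((2 : ℝ≥0∞) ^ (k : ℝ)) ^ p *
      volume A ^ (-(s * p / finrank ℝ E))) ≤ ∫⁻ y, ‖trunc u k x - trunc u k y‖ₑ ^ p *
      ENNReal.ofReal (1 / ‖x - y‖ ^ ((finrank ℝ E : ℝ) + s * p)) := by
    intro x hx
    refine le_trans ?_ (setLIntegral_le_lintegral Aᶜ _)
    rw [mul_left_comm]
    refine (mul_le_mul_right (le_setLIntegral_compl hs hs1 (by linarith) hsp x hAm h0 hA1)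
      _).trans ?_
    rw [← lintegral_const_mul' _ _ (by finiteness)]
    refine setLIntegral_mono' hAm.compl fun y hy => ?_
    rw [trunc_of_mem u hx, trunc_of_notMem u hy, sub_zero, ← ofReal_two_zpow,
      Real.enorm_of_nonneg (by positivity)]
  refine le_trans (le_of_eq ?_) (setLIntegral_mono' hBm hx)
  rw [setLIntegral_const]
  ring

lemma tsum_mul_rpow_le {ι : Type*} [MeasurableSpace ι] [MeasurableSingletonClass ι]
    {f g : ι → ℝ≥0∞} (hf : Measurable f) (hg : Measurable g) {a b : ℝ} (ha : 0 ≤ a) (hb : 0 ≤ b)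
    (hab : a + b = 1) :
    ∑' i, f i ^ a * g i ^ b ≤ (∑' i, f i) ^ a * (∑' i, g i) ^ b := by
  have h := ENNReal.lintegral_mul_norm_pow_le (μ := Measure.count) hf.aemeasurable hg.aemeasurable
    ha hb hab
  simpa only [lintegral_count] using h

/-- The level sum is controlled by the Gagliardo seminorm, with the constant that is sharp as
`s → 0`. -/
lemma levelSum_le_of_small [Nontrivial E] {s p : ℝ} (hs : 0 < s) (hs1 : s < 1) (hp : 1 < p)
    (hsp : s * p / finrank ℝ E ≤ 1 / 2) {u : E → ℝ} (hu : Measurable u)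
    (hup : ∫⁻ x, ‖u x‖ₑ ^ p ≠ ∞) (hG : gagliardoMeasure s p u univ ≠ ∞) :
    levelSum volume p (1 - s * p / finrank ℝ E) u ≤
      ENNReal.ofReal (4 ^ p * (s / farConst E p)) * gagliardoMeasure s p u univ := by
  have hn0 : 0 < (finrank ℝ E : ℝ) := by exact_mod_cast finrank_pos (R := ℝ) (M := E)
  have hsp' : s * p < finrank ℝ E := by
    rw [div_le_iff₀ hn0] at hsp; linarith
  have hc := farConst_pos (E := E) (by linarith : 0 < p)
  set c := farConst E p
  set θ := s * p / finrank ℝ E with hθ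
  have hθ0 : 0 < θ := by positivity
  set X := levelSum volume p (1 - θ) u with hX
  set a : ℤ → ℝ≥0∞ := fun k => volume (levelSet u k) with ha
  set w : ℤ → ℝ≥0∞ := fun k => ((2 : ℝ≥0∞) ^ (k : ℝ)) ^ p with hw
  set Y : ℝ≥0∞ := ∑' k, w k * (a (k + 1) * a k ^ (-θ)) with hY
  -- Finiteness, known from the other bound, is what permits dividing by X^θ below.
  have hXtop : X ≠ ∞ :=
    ne_top_of_le_ne_top (by finiteness) (levelSum_le_one_sub hs.le hs1 hp hsp' hu hup)
  have hYle : Y ≤ ENNReal.ofReal (s / c) * gagliardoMeasure s p u univ := by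
    have h1 : ENNReal.ofReal (c / s) * Y ≤ gagliardoMeasure s p u univ := by
      rw [hY, ← ENNReal.tsum_mul_left]
      exact (ENNReal.tsum_le_tsum fun k =>
        le_gagliardoMeasure_trunc hs hs1 hp hsp' hu hup k).trans
        (tsum_gagliardoMeasure_trunc_le hp.le hu)
    calc Y = ENNReal.ofReal (s / c) * (ENNReal.ofReal (c / s) * Y) := by
          rw [← mul_assoc, ← ENNReal.ofReal_mul (by positivity), div_mul_div_comm, mul_comm s c,
            div_self (by positivity), ENNReal.ofReal_one, one_mul]
      _ ≤ _ := by gcongr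
  -- The powers of a k cancel on the right, since -θ(1-θ) + (1-θ)θ = 0. Summed by Hölder, this gives
  -- the self-improving bound X ≤ 2^p Y^(1-θ) X^θ.
  have hterm : ∀ k, w k * a (k + 1) ^ (1 - θ) ≤
      (w k * (a (k + 1) * a k ^ (-θ))) ^ (1 - θ) * (w k * a k ^ (1 - θ)) ^ θ := by
    intro k
    have hw0 : w k ≠ 0 :=
      (ENNReal.rpow_pos (ENNReal.rpow_pos two_pos (by finiteness)) (by finiteness)).ne'
    have hw1 : w k ≠ ∞ := by simp only [hw]; finiteness
    rcases eq_or_ne (a k) 0 with h0 | h0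
    · have : a (k + 1) = 0 := measure_mono_null (levelSet_succ_subset u k) h0
      rw [this, ENNReal.zero_rpow_of_pos (by linarith), mul_zero]
      exact zero_le
    have h1 : a k ≠ ∞ := measure_levelSet_ne_top (by linarith) hup k hu
    refine le_of_eq ?_
    rw [ENNReal.mul_rpow_of_nonneg _ _ (by linarith), ENNReal.mul_rpow_of_nonneg _ _ (by linarith),
      ENNReal.mul_rpow_of_nonneg _ _ hθ0.le,
      ← ENNReal.rpow_mul (a k), ← ENNReal.rpow_mul (a k)]
    calc w k * a (k + 1) ^ (1 - θ) = (w k ^ (1 - θ) * w k ^ θ) * a (k + 1) ^ (1 - θ) *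
        (a k ^ (-θ * (1 - θ)) * a k ^ ((1 - θ) * θ)) := by
          rw [← ENNReal.rpow_add _ _ hw0 hw1, ← ENNReal.rpow_add _ _ h0 h1]
          have e1 : 1 - θ + θ = 1 := by ring
          have e2 : -θ * (1 - θ) + (1 - θ) * θ = 0 := by ring
          rw [e1, e2, ENNReal.rpow_one, ENNReal.rpow_zero, mul_one]
      _ = _ := by ring
  have hrec : X ≤ 2 ^ p * (Y ^ (1 - θ) * X ^ θ) := by
    refine (levelSum_succ p (1 - θ) u).le.trans (mul_le_mul_right ?_ _)
    refine (ENNReal.tsum_le_tsum hterm).trans ?_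
    exact tsum_mul_rpow_le (measurable_of_countable _) (measurable_of_countable _) (by linarith)
      hθ0.le (by ring)
  have hXY : X ≤ ENNReal.ofReal (4 ^ p) * Y := by
    rcases eq_or_ne X 0 with h0 | h0
    · rw [h0]; exact zero_le
    have hXθ0 : X ^ θ ≠ 0 := (ENNReal.rpow_pos (pos_iff_ne_zero.2 h0) hXtop).ne'
    have hXθ1 : X ^ θ ≠ ∞ := by finiteness
    have h1 : X ^ (1 - θ) ≤ 2 ^ p * Y ^ (1 - θ) := by
      have h2 : X ^ (1 - θ) * X ^ θ ≤ 2 ^ p * Y ^ (1 - θ) * X ^ θ := by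
        rw [← ENNReal.rpow_add _ _ h0 hXtop, sub_add_cancel, ENNReal.rpow_one, mul_assoc]
        exact hrec
      exact (ENNReal.mul_le_mul_iff_left hXθ0 hXθ1).1 h2
    -- As θ ≤ 1/2, 2^p ≤ 4^(p(1-θ)).
    have h3 : X ^ (1 - θ) ≤ (ENNReal.ofReal (4 ^ p) * Y) ^ (1 - θ) := by
      rw [ENNReal.mul_rpow_of_nonneg _ _ (by linarith)]
      refine h1.trans (mul_le_mul_left ?_ _)
      rw [← ENNReal.ofReal_ofNat 2, ENNReal.ofReal_rpow_of_pos two_pos,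
        ENNReal.ofReal_rpow_of_pos (by positivity)]
      refine ENNReal.ofReal_le_ofReal ?_
      have e4 : (4 : ℝ) = 2 ^ (2 : ℝ) := by norm_num
      rw [e4, ← Real.rpow_mul two_pos.le, ← Real.rpow_mul two_pos.le]
      exact Real.rpow_le_rpow_of_exponent_le (by norm_num) (by nlinarith)
    exact (ENNReal.rpow_le_rpow_iff (by linarith)).1 h3
  refine hXY.trans ?_
  rw [ENNReal.ofReal_mul (by positivity), mul_assoc]
  gcongr

/-- The constant in the fractional Sobolev inequality. -/
noncomputable def fracSobolevConst (E : Type*) [NormedAddCommGroup E] [NormedSpace ℝ E]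
    [MeasureSpace E] (p : ℝ) : ℝ :=
  2 ^ p * (4 ^ p / farConst E p * (2 * (finrank ℝ E : ℝ) ^ (p - 1)) +
    2 ^ p * weakConst E p / min (1 / 2) (finrank ℝ E / (2 * p)))

lemma fracSobolevConst_pos [Nontrivial E] {p : ℝ} (hp : 1 < p) : 0 < fracSobolevConst E p := by
  have := farConst_pos (E := E) (by linarith : 0 < p)
  have := weakConst_pos (E := E) hp
  have hn0 : 0 < (finrank ℝ E : ℝ) := by exact_mod_cast finrank_pos (R := ℝ) (M := E)
  unfold fracSobolevConst
  positivity

lemma levelSum_le [Nontrivial E] {s p : ℝ} (hs : 0 < s) (hs1 : s < 1) (hp : 1 < p)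
    (hsp : s * p < finrank ℝ E) {u : E → ℝ} (hu : Measurable u)
    (hup : ∫⁻ x, ‖u x‖ₑ ^ p ≠ ∞) (hG : gagliardoMeasure s p u univ ≠ ∞) :
    2 ^ p * levelSum volume p (1 - s * p / finrank ℝ E) u ≤
      ENNReal.ofReal (fracSobolevConst E p *
        (s * (1 - s) / ((finrank ℝ E : ℝ) - s * p) ^ (p - 1))) *
        gagliardoMeasure s p u univ := by
  have hn0 : 0 < (finrank ℝ E : ℝ) := by exact_mod_cast finrank_pos (R := ℝ) (M := E)
  have hc := farConst_pos (E := E) (by linarith : 0 < p)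
  have hw := weakConst_pos (E := E) hp
  set n : ℝ := (finrank ℝ E : ℝ) with hn
  -- For s ≤ s₀ both sp/n ≤ 1/2 and 1-s ≥ 1/2, so the bound with s applies. For s > s₀ the missing
  -- factor s costs at most 1/s₀.
  set s₀ := min (1 / 2) (n / (2 * p)) with hs₀
  have hs₀' : 0 < s₀ := by positivity
  have hns : 0 < n - s * p := by linarith
  have hp1 : 0 < p - 1 := by linarith
  have h1s : 0 < 1 - s := by linarith
  set W := (n - s * p) ^ (p - 1) with hW
  have hW0 : 0 < W := by positivity
  rw [fracSobolevConst, ← hn, ← hs₀, mul_assoc (2 ^ p : ℝ), ENNReal.ofReal_mul (by positivity),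
    ← ENNReal.ofReal_rpow_of_pos two_pos, ENNReal.ofReal_ofNat, mul_assoc (2 ^ p : ℝ≥0∞)]
  refine mul_le_mul_right ?_ _
  rcases le_or_gt s s₀ with h | h
  · have h1 : s ≤ 1 / 2 := h.trans (min_le_left _ _)
    have h2 : s ≤ n / (2 * p) := h.trans (min_le_right _ _)
    have h3 : s * p / n ≤ 1 / 2 := by
      rw [le_div_iff₀ (by positivity)] at h2
      rw [div_le_iff₀ hn0]; linarith
    refine (levelSum_le_of_small hs hs1 hp h3 hu hup hG).trans
      (mul_le_mul_left (ENNReal.ofReal_le_ofReal ?_) _)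
    have h4 : W ≤ n ^ (p - 1) := Real.rpow_le_rpow hns.le (by nlinarith) hp1.le
    have h5 : s ≤ 2 * n ^ (p - 1) * (s * (1 - s) / W) := by
      rw [mul_div_assoc', le_div_iff₀ hW0]
      have : 0 < s * n ^ (p - 1) := by positivity
      nlinarith
    calc 4 ^ p * (s / farConst E p) ≤
        4 ^ p * ((2 * n ^ (p - 1) * (s * (1 - s) / W)) / farConst E p) := by gcongr
      _ = 4 ^ p / farConst E p * (2 * n ^ (p - 1)) * (s * (1 - s) / W) := by ring
      _ ≤ _ := by
        gcongr
        have : 0 < 2 ^ p * weakConst E p / s₀ := by positivity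
        linarith
  · refine (levelSum_le_one_sub hs.le hs1 hp hsp hu hup).trans
      (mul_le_mul_left (ENNReal.ofReal_le_ofReal ?_) _)
    rw [← hn, ← hW]
    have h6 : 1 ≤ s / s₀ := (one_le_div hs₀').2 h.le
    calc 2 ^ p * weakConst E p * ((1 - s) / W)
        ≤ 2 ^ p * weakConst E p * ((1 - s) / W) * (s / s₀) :=
          le_mul_of_one_le_right (by positivity) h6
      _ = 2 ^ p * weakConst E p / s₀ * (s * (1 - s) / W) := by ring
      _ ≤ _ := by
        gcongr
        have : 0 < 4 ^ p / farConst E p * (2 * n ^ (p - 1)) := by positivity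
        linarith

/-- The fractional Sobolev inequality with the Maz'ya-Shaposhnikova constant. -/
theorem fracSobolev [Nontrivial E] {s p P : ℝ} (hs : 0 < s) (hs1 : s < 1) (hp : 1 < p)
    (hsp : s * p < finrank ℝ E) (hP : P = finrank ℝ E * p / (finrank ℝ E - s * p)) {u : E → ℝ}
    (hu : Measurable u) (hup : ∫⁻ x, ‖u x‖ₑ ^ p ≠ ∞) (hG : gagliardoMeasure s p u univ ≠ ∞) :
    (∫⁻ x, ‖u x‖ₑ ^ P) ^ (p / P) ≤
      ENNReal.ofReal (fracSobolevConst E p *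
        (s * (1 - s) / ((finrank ℝ E : ℝ) - s * p) ^ (p - 1))) *
        gagliardoMeasure s p u univ := by
  have hn0 : 0 < (finrank ℝ E : ℝ) := by exact_mod_cast finrank_pos (R := ℝ) (M := E)
  have hns : 0 < (finrank ℝ E : ℝ) - s * p := by linarith
  have hpP : p ≤ P := by
    rw [hP, le_div_iff₀ hns]
    have : 0 < s * p * p := by positivity
    nlinarith
  have e : p / P = 1 - s * p / finrank ℝ E := by
    rw [hP]; field_simp
  refine (rpow_lintegral_le_levelSum (by linarith) hpP hu).trans ?_
  rw [e]
  exact levelSum_le hs hs1 hp hsp hu hup hG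

end General

/-! ### Interpolation of Lebesgue norms. -/

section Interpolation

lemma eLpNorm_ofReal_eq {X : Type*} [MeasurableSpace X] {μ : Measure X} {r : ℝ} (hr : 0 < r)
    (u : X → ℝ) : eLpNorm u (ENNReal.ofReal r) μ = (∫⁻ x, ‖u x‖ₑ ^ r ∂μ) ^ (1 / r) := by
  rw [eLpNorm_eq_lintegral_rpow_enorm_toReal (by simpa using hr) ENNReal.ofReal_ne_top,
    ENNReal.toReal_ofReal hr.le]

lemma eLpNorm_le_interpolate {X : Type*} [MeasurableSpace X] {μ : Measure X} {q r P a : ℝ}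
    (hq : 0 < q) (hr : 0 < r) (hP : 0 < P) (ha : 0 ≤ a) (ha1 : a ≤ 1)
    (h : a * r / P + (1 - a) * r / q = 1) {u : X → ℝ} (hu : Measurable u) :
    eLpNorm u (ENNReal.ofReal r) μ ≤
      eLpNorm u (ENNReal.ofReal P) μ ^ a * eLpNorm u (ENNReal.ofReal q) μ ^ (1 - a) := by
  have ha' : 0 ≤ 1 - a := by linarith
  have hα : 0 ≤ a * r / P := by positivity
  have hβ : 0 ≤ (1 - a) * r / q := by positivity
  have h1 := ENNReal.lintegral_mul_norm_pow_le (μ := μ) (hu.enorm.pow_const P).aemeasurable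
    (hu.enorm.pow_const q).aemeasurable hα hβ h
  have e : ∀ x, (‖u x‖ₑ ^ P) ^ (a * r / P) * (‖u x‖ₑ ^ q) ^ ((1 - a) * r / q) = ‖u x‖ₑ ^ r := by
    intro x
    rw [← ENNReal.rpow_mul, ← ENNReal.rpow_mul, ← ENNReal.rpow_add_of_nonneg _ _ (by positivity)
      (by positivity)]
    congr 1
    field_simp
    ring
  simp only [e] at h1
  rw [eLpNorm_ofReal_eq hq, eLpNorm_ofReal_eq hr, eLpNorm_ofReal_eq hP]
  refine (ENNReal.rpow_le_rpow h1 (by positivity : 0 ≤ 1 / r)).trans (le_of_eq ?_)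
  rw [ENNReal.mul_rpow_of_nonneg _ _ (by positivity), ← ENNReal.rpow_mul, ← ENNReal.rpow_mul,
    ← ENNReal.rpow_mul, ← ENNReal.rpow_mul]
  congr 2 <;> field_simp

end Interpolation

/-! ### Transfer to the stated seminorm, and the exponents. -/

section Euclidean

variable {d : ℕ}

lemma gagliardo_congr {s p : ℝ} {u v : EuclideanSpace ℝ (Fin d) → ℝ} (h : u =ᵐ[volume] v) :
    gagliardo d s p u = gagliardo d s p v := by
  unfold gagliardo
  congr 1
  refine lintegral_congr_ae ?_
  filter_upwards [h] with y hy
  refine lintegral_congr_ae ?_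
  filter_upwards [h] with x hx
  rw [hx, hy]

lemma gagliardo_eq_rpow {s p : ℝ} (hp : 0 ≤ p) {u : EuclideanSpace ℝ (Fin d) → ℝ}
    (hu : Measurable u) : gagliardo d s p u = gagliardoMeasure s p u univ ^ (1 / p) := by
  have hm : Measurable fun z : EuclideanSpace ℝ (Fin d) × EuclideanSpace ℝ (Fin d) =>
      ‖u z.1 - u z.2‖ₑ ^ p *
        ENNReal.ofReal (1 / ‖z.1 - z.2‖ ^ ((finrank ℝ (EuclideanSpace ℝ (Fin d)) : ℝ) + s * p)) :=
    (measurable_diff hu).mul (measurable_gagliardo_kernel _)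
  rw [gagliardo, gagliardoMeasure, withDensity_apply _ MeasurableSet.univ, Measure.restrict_univ,
    Measure.volume_eq_prod, lintegral_prod_symm _ hm.aemeasurable]
  congr 1
  refine lintegral_congr fun y => lintegral_congr fun x => ?_
  rw [finrank_euclideanSpace_fin, div_eq_mul_one_div, ENNReal.ofReal_mul (by positivity),
    ← ENNReal.ofReal_rpow_of_nonneg (abs_nonneg _) hp, ← Real.norm_eq_abs, ofReal_norm]

lemma lt_top_of_wspNorm_lt_top {s p : ℝ} (hp : 0 < p) {u : EuclideanSpace ℝ (Fin d) → ℝ}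
    (h : wspNorm d s p u < ∞) :
    eLpNorm u (ENNReal.ofReal p) volume < ∞ ∧ gagliardo d s p u < ∞ := by
  rw [wspNorm, ENNReal.rpow_lt_top_iff_of_pos (by positivity), ENNReal.add_lt_top,
    ENNReal.rpow_lt_top_iff_of_pos hp, ENNReal.rpow_lt_top_iff_of_pos hp] at h
  exact h

/-- The fractional Sobolev inequality for elements of `W^{s,p}(ℝ^d)`. -/
lemma eLpNorm_le_gagliardo (hd : 0 < d) {s p P : ℝ} (hs : 0 < s) (hs1 : s < 1) (hp : 1 < p)
    (hsp : s * p < d) (hP : P = d * p / (d - s * p)) {u : EuclideanSpace ℝ (Fin d) → ℝ}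
    (hu : Measurable u) (hW : wspNorm d s p u < ∞) :
    eLpNorm u (ENNReal.ofReal P) volume ≤
      (ENNReal.ofReal (sobolevConst (fracSobolevConst (EuclideanSpace ℝ (Fin d)) p) d s p) *
        gagliardo d s p u ^ p) ^ (1 / p) := by
  have hp0 : 0 < p := by linarith
  have : Nonempty (Fin d) := ⟨⟨0, hd⟩⟩
  obtain ⟨h1, h2⟩ := lt_top_of_wspNorm_lt_top hp0 hW
  have hfr : (finrank ℝ (EuclideanSpace ℝ (Fin d)) : ℝ) = d := by
    rw [finrank_euclideanSpace_fin]
  have hd' : (0 : ℝ) < d := by exact_mod_cast hd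
  have hP0 : 0 < P := by
    rw [hP]; exact div_pos (by positivity) (by linarith)
  have hup : ∫⁻ x, ‖u x‖ₑ ^ p ≠ ∞ := by
    rw [eLpNorm_ofReal_eq hp0, ENNReal.rpow_lt_top_iff_of_pos (by positivity)] at h1
    exact h1.ne
  have hG : gagliardoMeasure s p u univ ≠ ∞ := by
    rw [gagliardo_eq_rpow hp0.le hu, ENNReal.rpow_lt_top_iff_of_pos (by positivity)] at h2
    exact h2.ne
  have hS := fracSobolev (P := P) hs hs1 hp (by rw [hfr]; exact hsp) (by rw [hfr]; exact hP) hu hup hG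
  rw [hfr] at hS
  have hE : gagliardo d s p u ^ p = gagliardoMeasure s p u univ := by
    rw [gagliardo_eq_rpow hp0.le hu, ← ENNReal.rpow_mul, one_div_mul_cancel hp0.ne',
      ENNReal.rpow_one]
  rw [hE, eLpNorm_ofReal_eq hP0]
  refine le_trans (le_of_eq ?_) (ENNReal.rpow_le_rpow hS (by positivity))
  rw [← ENNReal.rpow_mul]
  congr 1
  field_simp

/-- With δ = dp - (d-sp)q, one has (q-1)δ - d(q-p) = q(p(d-s) - q(d-sp)), so the upper bound on q is
exactly a < 1. It also gives δ > 0, since p(d-s) < dp. -/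
lemma exponent_bounds {d s p q r a : ℝ} (hd : 0 < d) (hs : 0 < s) (hp : 1 < p)
    (hsp : s * p < d) (hpq : p < q) (hq : q < p * (d - s) / (d - s * p))
    (hr : r = p * ((q - 1) / (p - 1)))
    (ha : a = d * (q - p) / ((q - 1) * (d * p - (d - s * p) * q))) :
    0 < d * p - (d - s * p) * q ∧ 0 < a ∧ a < 1 ∧ 0 < r ∧
      a * r / (d * p / (d - s * p)) + (1 - a) * r / q = 1 := by
  have hns : 0 < d - s * p := by linarith
  rw [lt_div_iff₀ hns] at hq
  have hδ : 0 < d * p - (d - s * p) * q := by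
    have : 0 < s * p := by positivity
    nlinarith
  have hq1 : 0 < q - 1 := by linarith
  have hp1 : 0 < p - 1 := by linarith
  have hq0 : 0 < q := by linarith
  have hp0 : 0 < p := by linarith
  refine ⟨hδ, ?_, ?_, ?_, ?_⟩
  · rw [ha]; exact div_pos (mul_pos hd (by linarith)) (by positivity)
  · rw [ha, div_lt_one (by positivity)]
    have : 0 < q * (p * (d - s) - q * (d - s * p)) := mul_pos hq0 (by linarith)
    nlinarith
  · rw [hr]; positivity
  · have hA : a * ((q - 1) * (d * p - (d - s * p) * q)) = d * (q - p) := by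
      rw [ha, div_mul_cancel₀ _ (mul_pos hq1 hδ).ne']
    rw [hr]
    field_simp
    linear_combination -hA

end Euclidean

end FracSobolev

theorem theorem2p2 (d : ℕ) (p : ℝ) (hp : 1 < p) :
    ∃ C : ℝ, 0 < C ∧
      ∀ s q r a : ℝ, 0 < s → s < 1 → s * p < (d : ℝ) →
        p < q → q < p * ((d : ℝ) - s) / ((d : ℝ) - s * p) →
        r = p * ((q - 1) / (p - 1)) → a = FracSobolev.interpExp d s p q →
        0 < (d : ℝ) * p - ((d : ℝ) - s * p) * q ∧
        ∀ u : EuclideanSpace ℝ (Fin d) → ℝ, FracSobolev.MemD d s p q u →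
          MeasureTheory.eLpNorm u (ENNReal.ofReal r) MeasureTheory.volume ≤
            ENNReal.ofReal (FracSobolev.sobolevConst C d s p ^ (a / p)) *
              FracSobolev.gagliardo d s p u ^ a *
              MeasureTheory.eLpNorm u (ENNReal.ofReal q) MeasureTheory.volume ^ (1 - a) := by

  rcases Nat.eq_zero_or_pos d with rfl | hd
  -- For d = 0 the condition sp < d cannot hold.
  · refine ⟨1, one_pos, fun s q r a hs _ hsp => ?_⟩
    have : 0 < s * p := mul_pos hs (by linarith)
    rw [Nat.cast_zero] at hsp
    linarith
  have : Nonempty (Fin d) := ⟨⟨0, hd⟩⟩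
  have hp0 : 0 < p := by linarith
  have hd' : (0 : ℝ) < d := by exact_mod_cast hd
  have hC := FracSobolev.fracSobolevConst_pos (E := EuclideanSpace ℝ (Fin d)) hp
  refine ⟨FracSobolev.fracSobolevConst (EuclideanSpace ℝ (Fin d)) p, hC, ?_⟩
  intro s q r a hs hs1 hsp hpq hq hr ha
  rw [FracSobolev.interpExp] at ha
  obtain ⟨hδ, ha0, ha1, hr0, hexp⟩ := FracSobolev.exponent_bounds hd' hs hp hsp hpq hq hr ha
  refine ⟨hδ, fun u hu => ?_⟩
  obtain ⟨⟨hum, hW, -⟩, -, -⟩ := hu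
  -- Both sides depend only on the class of u, so a Borel measurable representative may be used.
  have huv := hum.ae_eq_mk
  have hvm : Measurable (hum.mk u) := hum.stronglyMeasurable_mk.measurable
  set v := hum.mk u
  have hWv : FracSobolev.wspNorm d s p v < ∞ := by
    rw [FracSobolev.wspNorm, ← FracSobolev.gagliardo_congr huv,
      ← MeasureTheory.eLpNorm_congr_ae huv]
    exact hW
  rw [MeasureTheory.eLpNorm_congr_ae huv, MeasureTheory.eLpNorm_congr_ae huv,
    FracSobolev.gagliardo_congr huv]
  have hns : 0 < (d : ℝ) - s * p := by linarith
  have hP0 : 0 < (d : ℝ) * p / (d - s * p) := by positivity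
  refine (FracSobolev.eLpNorm_le_interpolate (by linarith : 0 < q) hr0 hP0 ha0.le ha1.le hexp
    hvm).trans ?_
  refine mul_le_mul_left ((ENNReal.rpow_le_rpow
    (FracSobolev.eLpNorm_le_gagliardo hd hs hs1 hp hsp rfl hvm hWv) ha0.le).trans (le_of_eq ?_)) _
  have h1s : 0 < 1 - s := by linarith
  have hK : 0 < FracSobolev.sobolevConst
      (FracSobolev.fracSobolevConst (EuclideanSpace ℝ (Fin d)) p) d s p := by
    unfold FracSobolev.sobolevConst
    positivity
  rw [ENNReal.mul_rpow_of_nonneg _ _ (by positivity), ENNReal.mul_rpow_of_nonneg _ _ ha0.le,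
    ← ENNReal.rpow_mul, ← ENNReal.rpow_mul, ← ENNReal.rpow_mul, ← mul_assoc p,
    mul_one_div_cancel hp0.ne', one_mul, one_div_mul_eq_div, ENNReal.ofReal_rpow_of_pos hK]
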